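/- **Conventions.** All diagrams lie on the sphere $S^2$ and are polygonal, with finitely many edges, each a great-circle arc shorter than a half circle; their only singularities are transversal double points. For $n\in\mathbb N$, a *linkoid diagram* with $n$ components is a generic immersion of $n$ intervals in $S^2$ with over/under data at every crossing; it has $2n$ endpoints. Two linkoid diagrams are *equivalent* if they are related by a finite sequence of isotopies of $S^2$ and Reidemeister moves $R_1,R_2,R_3$ performed away from the endpoints (no strand may be moved over or under an endpoint); a *linkoid* is an equivalence class. A *virtual link diagram* is a generic immersion of finitely many (unoriented) circles in $S^2$ in which each crossing is either classical (with over/under data) or virtual; a *virtual link* is an equivalence class of such diagrams under isotopy, the Reidemeister moves $R_1,R_2,R_3$ for classical crossings, and detour moves (a segment of the diagram all of whose crossings are virtual is replaced by any other generic segment with the same ends, all of whose crossings are taken to be virtual; this includes the virtual and semi-virtual Reidemeister moves). Label the endpoints of a linkoid diagram $L$ with $n$ components bijectively by $E=\{1,\dots,2n\}$, and let $H_n=\{\sigma\in S_{2n}:\sigma^2(i)=i,\ \sigma(i)\ne i\ \text{for all } i\in E\}$ be the set of *closure permutations*. For $\sigma\in H_n$, a *virtual closure diagram* of the labelled diagram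 $L$ with respect to $\sigma$ is a virtual link diagram consisting of $L$ and, for each pair $\{i,\sigma(i)\}$, a closure arc joining the endpoints labelled $i$ and $\sigma(i)$, where all crossings on the closure arcs are virtual. The *virtual spectrum* $\operatorname{spec}(L)$ is the set of all virtual links represented by virtual closure diagrams of $L$ with respect to some $\sigma\in H_n$. **Theorem 5.1.** Let $n\in\mathbb N$. 1. For every labelled linkoid diagram $L$ with $n$ components and every $\sigma\in H_n$, virtual closure diagrams of $L$ with respect to $\sigma$ exist and they all represent one and the same virtual link $(L,\sigma)_v$; thus $\operatorname{spec}(L)=\{(L,\sigma)_v:\sigma\in H_n\}$. 2. The virtual spectrum is a linkoid invariant: if $L_1$ and $L_2$ are equivalent linkoid diagrams with $n$ components, with arbitrary labellings of their endpoints, then $\operatorname{spec}(L_1)=\operatorname{spec}(L_2)$. -/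

import Mathlib

/-! Linkoid diagrams and virtual link diagrams on the sphere, in the piecewise linear category:
curves are polygons whose edges are arcs of great circles shorter than a half circle. -/

namespace VirtualSpectrum

/-- The unit sphere in Euclidean 3-space, on which all diagrams lie. -/
abbrev S2 : Type := Metric.sphere (0 : EuclideanSpace ℝ (Fin 3)) 1

/-- The closed great-circle arc (shorter than a half circle) spanned by an unordered pair of points:
the points of the sphere that are non-negative combinations of the two points. -/
def arc (e : Sym2 S2) : Set S2 :=
  {x | ∃ p q : S2, e = s(p, q) ∧ ∃ a b : ℝ, 0 ≤ a ∧ 0 ≤ b ∧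
    (x : EuclideanSpace ℝ (Fin 3)) = a • (p : EuclideanSpace ℝ (Fin 3)) + b • (q : EuclideanSpace ℝ (Fin 3))}

/-- The closed spherical triangle with vertices `p`, `q`, `r`. -/
def triangle (p q r : S2) : Set S2 :=
  {x | ∃ a b c : ℝ, 0 ≤ a ∧ 0 ≤ b ∧ 0 ≤ c ∧
    (x : EuclideanSpace ℝ (Fin 3)) = a • (p : EuclideanSpace ℝ (Fin 3))
      + b • (q : EuclideanSpace ℝ (Fin 3)) + c • (r : EuclideanSpace ℝ (Fin 3))}

/-- Two different edges meet in a point that is interior to both of them. -/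
def Crosses (e f : Sym2 S2) : Prop :=
  e ≠ f ∧ ∃ x : S2, x ∈ arc e ∧ x ∈ arc f ∧ x ∉ e ∧ x ∉ f

/-- A generic polygonal curve diagram on the sphere, with finitely many edges, possibly with several
components, closed or open, and with classical and virtual crossings.
The relation `isOver e f` says that the edges `e` and `f` have a classical crossing at which `e` is the
upper one; a crossing of two edges neither of which is over the other is a virtual crossing.
(Two edges cross at most once, because they are shorter than a half circle.) -/
structure Diagram where
  /-- the edges, given by their pairs of end vertices -/
  edges : Set (Sym2 S2)
  finite_edges : edges.Finite
  /-- the two vertices of an edge are neither equal nor antipodal -/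
  nondegenerate : ∀ p q : S2, s(p, q) ∈ edges → p ≠ q ∧ p ≠ -q
  /-- Two edges meet only in common vertices and in points interior to both. As a consequence they
  cannot overlap, so that they cross transversally in the latter case. -/
  generic : ∀ e ∈ edges, ∀ f ∈ edges, e ≠ f → ∀ x ∈ arc e ∩ arc f, (x ∈ e ↔ x ∈ f)
  /-- No point lies on three edges: all crossings are double points, and a vertex lies on at most two
  edges, so that the edges form a disjoint union of polygonal arcs and closed polygons. -/
  no_triple : ∀ e ∈ edges, ∀ f ∈ edges, ∀ g ∈ edges, e ≠ f → f ≠ g → e ≠ g →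
    arc e ∩ arc f ∩ arc g = ∅
  /-- the over/under data of the classical crossings -/
  isOver : Sym2 S2 → Sym2 S2 → Prop
  crosses_of_isOver : ∀ e f, isOver e f → e ∈ edges ∧ f ∈ edges ∧ Crosses e f
  isOver_asymm : ∀ e f, isOver e f → ¬ isOver f e

namespace Diagram

/-- The endpoints of the open components: the vertices that lie on exactly one edge. -/
def endpoints (D : Diagram) : Set S2 :=
  {p | ∃! e : Sym2 S2, e ∈ D.edges ∧ p ∈ e}

/-- The edges `e` and `f` have a classical crossing. -/
def Classical (D : Diagram) (e f : Sym2 S2) : Prop := D.isOver e f ∨ D.isOver f e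

/-- `D'` arises from `D` by replacing the edge `pq` by the two edges `pr` and `rq` of a
non-degenerate triangle `pqr`, nothing being changed on the other edges of `D`. -/
def Replaces (D D' : Diagram) (p q r : S2) : Prop :=
  LinearIndependent ℝ ![(p : EuclideanSpace ℝ (Fin 3)), (q : EuclideanSpace ℝ (Fin 3)),
    (r : EuclideanSpace ℝ (Fin 3))] ∧
  s(p, q) ∈ D.edges ∧ s(p, r) ∉ D.edges ∧ s(r, q) ∉ D.edges ∧
  D'.edges = (D.edges \ {s(p, q)}) ∪ {s(p, r), s(r, q)} ∧
  ∀ e ∈ D.edges \ {s(p, q)}, ∀ f ∈ D.edges \ {s(p, q)}, (D'.isOver e f ↔ D.isOver e f)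

/-- An edge meets the triangle `pqr` at most in the vertices `p` and `q`. -/
def Away (p q r : S2) (e : Sym2 S2) : Prop := arc e ∩ triangle p q r ⊆ {p, q}

/-- An edge traverses the triangle `pqr`, entering through the side `pq` and leaving through one of
the two other sides. -/
def Traverses (p q r : S2) (e : Sym2 S2) : Prop :=
  Crosses e s(p, q) ∧ (Crosses e s(p, r) ∨ Crosses e s(r, q))

/-- An edge `e` crosses the new edges `pr`, `rq` in the same way (over, under, or virtually) as it
crossed the old edge `pq`. -/
def SameType (D D' : Diagram) (p q r : S2) (e : Sym2 S2) : Prop :=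
  ∀ g ∈ ({s(p, r), s(r, q)} : Set (Sym2 S2)), Crosses e g →
    ((D'.isOver e g ↔ D.isOver e s(p, q)) ∧ (D'.isOver g e ↔ D.isOver s(p, q) e))

/-- Elementary planar isotopy: the edge `pq` is pushed across the triangle `pqr`, where the rest of the
diagram meets the triangle only in `p`, `q` and in pairwise disjoint segments
that run from `pq` to the two other sides. No crossing is created, removed or changed. -/
def Isotopy (D D' : Diagram) : Prop :=
  ∃ p q r : S2, Replaces D D' p q r ∧
    (∀ e ∈ D.edges \ {s(p, q)}, Away p q r e ∨ Traverses p q r e) ∧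
    (∀ e ∈ D.edges \ {s(p, q)}, ∀ f ∈ D.edges \ {s(p, q)}, e ≠ f →
      arc e ∩ arc f ∩ triangle p q r = ∅) ∧
    ∀ e ∈ D.edges \ {s(p, q)}, SameType D D' p q r e

/-- First Reidemeister move: of two consecutive edges `pq`, `qs` the first one is replaced by `pr`, `rq`
so that a kink arises, with one classical crossing, of `pr` and `qs`; the rest of the
diagram stays away from the triangle. -/
def ReidemeisterI (D D' : Diagram) : Prop :=
  ∃ p q r s : S2, Replaces D D' p q r ∧
    s(q, s) ∈ D.edges \ {s(p, q)} ∧ Crosses s(q, s) s(p, r) ∧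
    D'.Classical s(q, s) s(p, r) ∧
    ∀ e ∈ D.edges \ {s(p, q)}, e ≠ s(q, s) → Away p q r e

/-- Second Reidemeister move: the edge `pq` is pushed entirely over, or entirely under, a segment of
another edge `e`, which cuts off the corner `r` of the triangle; the rest of the
diagram stays away from the triangle. -/
def ReidemeisterII (D D' : Diagram) : Prop :=
  ∃ (p q r : S2) (e : Sym2 S2), Replaces D D' p q r ∧
    e ∈ D.edges \ {s(p, q)} ∧ Crosses e s(p, r) ∧ Crosses e s(r, q) ∧
    ((D'.isOver s(p, r) e ∧ D'.isOver s(r, q) e) ∨ (D'.isOver e s(p, r) ∧ D'.isOver e s(r, q))) ∧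
    ∀ f ∈ D.edges \ {s(p, q)}, f ≠ e → Away p q r f

/-- Third Reidemeister move: the edge `pq` is pushed across the crossing of two edges `e` and `f`, which
lies in the triangle. The three crossings involved are classical, one of the three
strands is over the two others, and the crossing types are kept; the rest of the
diagram stays away from the triangle. -/
def ReidemeisterIII (D D' : Diagram) : Prop :=
  ∃ (p q r : S2) (e f : Sym2 S2), Replaces D D' p q r ∧
    e ∈ D.edges \ {s(p, q)} ∧ f ∈ D.edges \ {s(p, q)} ∧ e ≠ f ∧
    Traverses p q r e ∧ Traverses p q r f ∧ (arc e ∩ arc f ∩ triangle p q r).Nonempty ∧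
    ((D.isOver s(p, q) e ∧ D.isOver s(p, q) f ∧ D.Classical e f) ∨
      (D.isOver e s(p, q) ∧ D.isOver e f ∧ D.Classical s(p, q) f) ∨
      (D.isOver f s(p, q) ∧ D.isOver f e ∧ D.Classical s(p, q) e)) ∧
    SameType D D' p q r e ∧ SameType D D' p q r f ∧
    ∀ g ∈ D.edges \ {s(p, q)}, g ≠ e → g ≠ f → Away p q r g

/-- Planar isotopy of a diagram near an endpoint `p`: the open component that ends in `p` is prolonged by
a new edge from `p` to `p'` that is disjoint from the rest of the diagram. (The
inverse of this move shortens the component; together they move endpoints about in the complement of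
the diagram, and no endpoint ever passes over or under a strand.) -/
def EndpointIsotopy (D D' : Diagram) : Prop :=
  ∃ p p' : S2, p ∈ D.endpoints ∧ s(p, p') ∉ D.edges ∧ D'.edges = insert s(p, p') D.edges ∧
    (∀ e ∈ D.edges, arc e ∩ arc s(p, p') ⊆ {p}) ∧
    ∀ e f, D'.isOver e f ↔ D.isOver e f

/-- The set `A` of edges forms a simple polygonal path of edges with end vertices `p` and `q`
(its edges may cross each other). -/
def IsPathBetween (A : Set (Sym2 S2)) (p q : S2) : Prop :=
  ∃ w : (SimpleGraph.fromEdgeSet A).Walk p q, w.IsPath ∧ {e | e ∈ w.edges} = A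

/-- Detour move: a path `A` of edges all of whose crossings are virtual is removed and replaced by
another path `B` with the same end vertices, all of whose crossings are again virtual. The
virtual Reidemeister moves and the semi-virtual move are special cases. -/
def Detour (D D' : Diagram) : Prop :=
  ∃ (C A B : Set (Sym2 S2)) (p q : S2), Disjoint C A ∧ Disjoint C B ∧
    D.edges = C ∪ A ∧ D'.edges = C ∪ B ∧ IsPathBetween A p q ∧ IsPathBetween B p q ∧
    (∀ e f, D.isOver e f → e ∈ C ∧ f ∈ C) ∧ ∀ e f, D'.isOver e f ↔ D.isOver e f

end Diagram

/-- A linkoid diagram with `n` components: only open components, all crossings classical.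
(There being no closed component, `n` open components are the same as `2 * n` endpoints.) -/
structure LinkoidDiagram (n : ℕ) extends Diagram where
  no_closed_component : (SimpleGraph.fromEdgeSet edges).IsAcyclic
  card_endpoints : toDiagram.endpoints.ncard = 2 * n
  all_classical : ∀ e ∈ edges, ∀ f ∈ edges, Crosses e f → toDiagram.Classical e f

/-- One Reidemeister move or elementary isotopy between linkoid diagrams. -/
def LinkoidMove {n : ℕ} (L L' : LinkoidDiagram n) : Prop :=
  L.toDiagram.Isotopy L'.toDiagram ∨ L.toDiagram.EndpointIsotopy L'.toDiagram ∨
  L.toDiagram.ReidemeisterI L'.toDiagram ∨ L.toDiagram.ReidemeisterII L'.toDiagram ∨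
  L.toDiagram.ReidemeisterIII L'.toDiagram

/-- Equivalence of linkoid diagrams: the equivalence relation generated by the three Reidemeister moves
and isotopy. A linkoid is an equivalence class. -/
def LinkoidEquiv {n : ℕ} : LinkoidDiagram n → LinkoidDiagram n → Prop :=
  Relation.EqvGen LinkoidMove

/-- A virtual link diagram: all components are closed. -/
structure VirtualLinkDiagram extends Diagram where
  no_endpoints : toDiagram.endpoints = ∅

/-- One Reidemeister move, elementary isotopy or detour move between virtual link diagrams. -/
def VirtualMove (D D' : VirtualLinkDiagram) : Prop :=
  D.toDiagram.Isotopy D'.toDiagram ∨ D.toDiagram.ReidemeisterI D'.toDiagram ∨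
  D.toDiagram.ReidemeisterII D'.toDiagram ∨ D.toDiagram.ReidemeisterIII D'.toDiagram ∨
  D.toDiagram.Detour D'.toDiagram

/-- Equivalence of virtual link diagrams. -/
def virtualSetoid : Setoid VirtualLinkDiagram := Relation.EqvGen.setoid VirtualMove

/-- A virtual link is an equivalence class of virtual link diagrams. -/
def VirtualLink : Type := Quotient virtualSetoid

/-- The virtual link represented by a diagram. -/
def VirtualLinkDiagram.toLink (D : VirtualLinkDiagram) : VirtualLink := Quotient.mk virtualSetoid D

/-- A labelling of the endpoints of a linkoid diagram by `2 * n` labels, without repetition. (It determines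
the strand permutation, which exchanges the labels of the two endpoints of every component.) -/
abbrev LinkoidDiagram.Labelling {n : ℕ} (L : LinkoidDiagram n) : Type :=
  Fin (2 * n) ≃ L.toDiagram.endpoints

/-- The set `H_n` of closure permutations: the involutions of the labels without fixed points. -/
def closurePermutations (n : ℕ) : Set (Equiv.Perm (Fin (2 * n))) :=
  {σ | ∀ i, σ (σ i) = i ∧ σ i ≠ i}

/-- `D` is a virtual closure diagram of the labelled linkoid diagram `(L, l)` with respect to `σ`: it
consists of `L` and of closure arcs `A i`, one between the endpoints labelled `i` and `σ i` for
every `i`; all crossings on the closure arcs are virtual. -/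
def IsClosureDiagram {n : ℕ} (L : LinkoidDiagram n) (l : L.Labelling)
    (σ : Equiv.Perm (Fin (2 * n))) (D : VirtualLinkDiagram) : Prop :=
  ∃ A : Fin (2 * n) → Set (Sym2 S2),
    (∀ i, Diagram.IsPathBetween (A i) (l i) (l (σ i))) ∧
    (∀ i, A (σ i) = A i) ∧
    (∀ i j, j ≠ i → j ≠ σ i → Disjoint (A i) (A j)) ∧
    (∀ i, Disjoint L.edges (A i)) ∧
    D.edges = L.edges ∪ ⋃ i, A i ∧
    ∀ e f, D.isOver e f ↔ L.isOver e f

/-- The virtual link `v` is a virtual closure of `(L, l)` with respect to `σ`. -/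
def IsVirtualClosure {n : ℕ} (L : LinkoidDiagram n) (l : L.Labelling)
    (σ : Equiv.Perm (Fin (2 * n))) (v : VirtualLink) : Prop :=
  ∃ D : VirtualLinkDiagram, IsClosureDiagram L l σ D ∧ D.toLink = v

/-- The virtual spectrum: the set of the virtual closures with respect to all closure permutations. -/
def spec {n : ℕ} (L : LinkoidDiagram n) (l : L.Labelling) : Set VirtualLink :=
  {v | ∃ σ ∈ closurePermutations n, IsVirtualClosure L l σ v}

end VirtualSpectrum

/-! Everything rests on general position. A generic point `c` avoids every plane through the origin
spanned by two vertices or double points of a diagram, so two endpoints `P`, `Q` can be joined by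
the virtual path `P c Q` without spoiling genericity (`addPath`). Closing the pairs of endpoints one
after another gives existence.

For uniqueness, take two closure diagrams for the same `σ`. Since a closure arc carries only virtual
crossings, a detour move replaces it by a path `P c Q` (`IsClosureFamily.exists_replace`), and `c`
can be chosen generic for both diagrams at once. When all arcs have been replaced, the two diagrams
have the same edges and the same over/under data, so they are equal.

For invariance, relabelling the endpoints only conjugates `σ`, and uniqueness allows the closure
arcs to be chosen conveniently. An isotopy or Reidemeister move takes place in a triangle `pqr` that
contains no endpoint except possibly `p` and `q`. If the inner vertices of the closure arcs lie in
the interior of the antipodal triangle, the arcs meet `pqr` at most in `p` and `q`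
(`IsDualBasis.away`), and the same move carries one closed diagram to the other
(`exists_isCommonExtension`). When a component is prolonged at an endpoint, no move is needed: a
closure diagram of the longer linkoid is one of the shorter linkoid, the new edge being counted as
part of the closure arc. -/

namespace VirtualSpectrum

/-! ### Great-circle arcs and their intersections. -/

/-- Euclidean 3-space. -/
abbrev E3 : Type := EuclideanSpace ℝ (Fin 3)

theorem norm_coe_S2 (p : S2) : ‖(p : E3)‖ = 1 := norm_eq_of_mem_sphere p

theorem mem_arc_mk {p q x : S2} :
    x ∈ arc s(p, q) ↔ ∃ a b : ℝ, 0 ≤ a ∧ 0 ≤ b ∧ (x : E3) = a • (p : E3) + b • (q : E3) := by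
  constructor
  · rintro ⟨p', q', h, a, b, ha, hb, hx⟩
    rcases Sym2.eq_iff.1 h with ⟨rfl, rfl⟩ | ⟨rfl, rfl⟩
    · exact ⟨a, b, ha, hb, hx⟩
    · exact ⟨b, a, hb, ha, by rw [hx, add_comm]⟩
  · rintro ⟨a, b, ha, hb, hx⟩
    exact ⟨p, q, rfl, a, b, ha, hb, hx⟩

theorem left_mem_arc (p q : S2) : p ∈ arc s(p, q) :=
  mem_arc_mk.2 ⟨1, 0, zero_le_one, le_rfl, by simp⟩

theorem mem_arc_of_mem {e : Sym2 S2} {x : S2} (h : x ∈ e) : x ∈ arc e := by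
  obtain ⟨y, rfl⟩ := h
  exact left_mem_arc x y

theorem smul_eq_smul_S2 {p q : S2} {a b : ℝ} (ha : 0 ≤ a) (hb : 0 ≤ b)
    (h : a • (p : E3) = b • (q : E3)) : a = b ∧ (a = 0 ∨ p = q) := by
  have hn := congrArg norm h
  rw [norm_smul, norm_smul, norm_coe_S2, norm_coe_S2, Real.norm_of_nonneg ha,
    Real.norm_of_nonneg hb, mul_one, mul_one] at hn
  refine ⟨hn, or_iff_not_imp_left.2 fun h0 => Subtype.ext ?_⟩
  subst hn
  exact smul_right_injective _ h0 h

theorem eq_of_coe_eq_smul {x p : S2} {a : ℝ} (ha : 0 ≤ a) (h : (x : E3) = a • (p : E3)) : x = p := by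
  have h' : (1 : ℝ) • (x : E3) = a • (p : E3) := by rw [one_smul, h]
  exact (smul_eq_smul_S2 zero_le_one ha h').2.resolve_left one_ne_zero

/-- Points that are neither equal nor antipodal are linearly independent. -/
theorem coeffs_eq_zero {p q : S2} (h₁ : p ≠ q) (h₂ : p ≠ -q) {a b : ℝ}
    (h : a • (p : E3) + b • (q : E3) = 0) : a = 0 ∧ b = 0 := by
  have hab : a • (p : E3) = (-b) • (q : E3) := by rw [neg_smul]; exact eq_neg_of_add_eq_zero_left h
  have hn := congrArg norm hab
  rw [norm_smul, norm_smul, norm_coe_S2, norm_coe_S2, mul_one, mul_one, norm_neg, Real.norm_eq_abs,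
    Real.norm_eq_abs] at hn
  have ha : a = 0 := by
    by_contra ha
    rcases abs_eq_abs.1 hn with rfl | rfl
    · apply h₂
      apply Subtype.ext
      apply smul_right_injective _ ha
      simpa using hab
    · apply h₁
      apply Subtype.ext
      apply smul_right_injective _ ha
      simpa using hab
  exact ⟨ha, by simpa [ha] using hn.symm⟩

theorem coeffs_eq {p q : S2} (h₁ : p ≠ q) (h₂ : p ≠ -q) {a b a' b' : ℝ}
    (h : a • (p : E3) + b • (q : E3) = a' • (p : E3) + b' • (q : E3)) : a = a' ∧ b = b' := by
  have := coeffs_eq_zero h₁ h₂ (a := a - a') (b := b - b')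
    (Eq.trans (by module) (sub_eq_zero.2 h))
  exact ⟨sub_eq_zero.1 this.1, sub_eq_zero.1 this.2⟩

/-- A point in the interior of an arc is a strictly positive combination of the vertices. -/
theorem pos_of_mem_arc {p q x : S2} (hx : x ∈ arc s(p, q)) (h : x ∉ s(p, q)) :
    ∃ a b : ℝ, 0 < a ∧ 0 < b ∧ (x : E3) = a • (p : E3) + b • (q : E3) := by
  obtain ⟨a, b, ha, hb, hab⟩ := mem_arc_mk.1 hx
  refine ⟨a, b, ha.lt_of_ne ?_, hb.lt_of_ne ?_, hab⟩
  · rintro rfl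
    exact h (by simp [eq_of_coe_eq_smul hb (by simpa using hab)])
  · rintro rfl
    exact h (by simp [eq_of_coe_eq_smul ha (by simpa using hab)])

/-- Two coplanar arcs that overlap, neither of which has a vertex in the interior of the other,
begin in the same vertex. -/
theorem left_eq_of_overlap {p q u v x : S2} (hpq : p ≠ q) (hpq' : p ≠ -q)
    {u₁ u₂ v₁ v₂ x₁ x₂ c d : ℝ} (hu : (u : E3) = u₁ • (p : E3) + u₂ • (q : E3))
    (hv : (v : E3) = v₁ • (p : E3) + v₂ • (q : E3))
    (hx : (x : E3) = x₁ • (p : E3) + x₂ • (q : E3)) (hx₁ : 0 < x₁) (hx₂ : 0 < x₂)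
    (hc : 0 < c) (hd : 0 < d) (hx' : (x : E3) = c • (u : E3) + d • (v : E3))
    (hdet : 0 < u₁ * v₂ - u₂ * v₁)
    (hgp : p ∈ arc s(u, v) → p ∈ s(u, v)) (hgu : u ∈ arc s(p, q) → u ∈ s(p, q)) : u = p := by
  have hcoef : x₁ = c * u₁ + d * v₁ ∧ x₂ = c * u₂ + d * v₂ := by
    apply coeffs_eq hpq hpq'
    rw [← hx, hx', hu, hv]
    module
  -- In the oriented plane of `p`, `q`, the point `x` lies between `u` and `v`, so `(u, x)` and `(x,
  -- v)` have the orientation of `(u, v)`. It remains to see on which side of `p` the point `u`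
  -- lies.
  have hdu : 0 < u₁ * x₂ - u₂ * x₁ := by
    have : u₁ * x₂ - u₂ * x₁ = d * (u₁ * v₂ - u₂ * v₁) := by rw [hcoef.1, hcoef.2]; ring
    rw [this]; positivity
  have hdv : 0 < x₁ * v₂ - x₂ * v₁ := by
    have : x₁ * v₂ - x₂ * v₁ = c * (u₁ * v₂ - u₂ * v₁) := by rw [hcoef.1, hcoef.2]; ring
    rw [this]; positivity
  rcases lt_or_ge u₂ 0 with h | h
  · have hp : p ∈ arc s(u, v) := by
      -- Here `u` lies before `p`, so `p` lies between `u` and `x`. The coefficients come from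
      -- eliminating `q` between the expansions of `u` and `x`, and then writing `x` in terms of `u`
      -- and `v`.
      refine mem_arc_mk.2 ⟨(x₂ - u₂ * c) / (u₁ * x₂ - u₂ * x₁), (-u₂ * d) / (u₁ * x₂ - u₂ * x₁),
        div_nonneg (by nlinarith) hdu.le, div_nonneg (by nlinarith) hdu.le, ?_⟩
      have key : (u₁ * x₂ - u₂ * x₁) • (p : E3) = (x₂ - u₂ * c) • (u : E3) + (-u₂ * d) • (v : E3) := by
        have h1 : (x₂ - u₂ * c) • (u : E3) + (-u₂ * d) • (v : E3)
            = x₂ • (u : E3) - u₂ • (c • (u : E3) + d • (v : E3)) := by module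
        rw [h1, ← hx', hx, hu]
        module
      apply smul_right_injective _ hdu.ne'
      simp only [smul_add, smul_smul]
      rw [mul_div_cancel₀ _ hdu.ne', mul_div_cancel₀ _ hdu.ne', key]
    rcases Sym2.mem_iff.1 (hgp hp) with h' | h'
    · exact h'.symm
    · subst h'
      have := coeffs_eq hpq hpq' (a := 1) (b := 0) (by rw [← hv]; module)
      rw [← this.1, ← this.2] at hdv
      linarith
  -- Here `u` lies between `p` and `x`, hence on the arc `pq`; the positive first coordinate
  -- excludes `u = q`.
  · have h1 : 0 < u₁ := by
      by_contra h1
      nlinarith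
    rcases Sym2.mem_iff.1 (hgu (mem_arc_mk.2 ⟨u₁, u₂, h1.le, h, hu⟩)) with h' | h'
    · exact h'
    · subst h'
      have := coeffs_eq hpq hpq' (a := 0) (b := 1) (by rw [← hu]; module)
      rw [← this.1] at h1
      exact absurd h1 (lt_irrefl _)

/-- Coplanar arcs with a common interior point coincide unless one has a vertex in the interior of
the other. -/
theorem eq_of_overlap {p q u v x : S2} (hpq : p ≠ q) (hpq' : p ≠ -q) (huv : u ≠ v) (huv' : u ≠ -v)
    {u₁ u₂ v₁ v₂ : ℝ} (hu : (u : E3) = u₁ • (p : E3) + u₂ • (q : E3))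
    (hv : (v : E3) = v₁ • (p : E3) + v₂ • (q : E3))
    (hx : x ∈ arc s(p, q)) (hxn : x ∉ s(p, q)) (hx' : x ∈ arc s(u, v)) (hxn' : x ∉ s(u, v))
    (hg : ∀ y ∈ arc s(p, q) ∩ arc s(u, v), (y ∈ s(p, q) ↔ y ∈ s(u, v))) : s(p, q) = s(u, v) := by
  have hdet : u₁ * v₂ - u₂ * v₁ ≠ 0 := by
    intro h0
    have h1 : v₂ • (u : E3) + (-u₂) • (v : E3) = 0 := by
      have : v₂ • (u : E3) + (-u₂) • (v : E3) = (u₁ * v₂ - u₂ * v₁) • (p : E3) := by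
        rw [hu, hv]; module
      rw [this, h0, zero_smul]
    have h2 : v₁ • (u : E3) + (-u₁) • (v : E3) = 0 := by
      have : v₁ • (u : E3) + (-u₁) • (v : E3) = (-(u₁ * v₂ - u₂ * v₁)) • (q : E3) := by
        rw [hu, hv]; module
      rw [this, h0, neg_zero, zero_smul]
    have h3 := coeffs_eq_zero huv huv' h1
    have h4 := coeffs_eq_zero huv huv' h2
    have : (v : E3) = 0 := by rw [hv, h3.1, h4.1]; simp
    have hn := norm_coe_S2 v
    rw [this, norm_zero] at hn
    exact zero_ne_one hn
  have aux : ∀ {u v : S2} {u₁ u₂ v₁ v₂ : ℝ}, (u : E3) = u₁ • (p : E3) + u₂ • (q : E3) →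
      (v : E3) = v₁ • (p : E3) + v₂ • (q : E3) → x ∈ arc s(u, v) → x ∉ s(u, v) →
      (∀ y ∈ arc s(p, q) ∩ arc s(u, v), (y ∈ s(p, q) ↔ y ∈ s(u, v))) →
      0 < u₁ * v₂ - u₂ * v₁ → s(p, q) = s(u, v) := by
    intro u v u₁ u₂ v₁ v₂ hu hv hx' hxn' hg hdet
    obtain ⟨x₁, x₂, hx₁, hx₂, hxe⟩ := pos_of_mem_arc hx hxn
    obtain ⟨c, d, hc, hd, hxe'⟩ := pos_of_mem_arc hx' hxn'
    have e1 : u = p := left_eq_of_overlap hpq hpq' hu hv hxe hx₁ hx₂ hc hd hxe' hdet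
      (fun h => (hg p ⟨left_mem_arc p q, h⟩).1 (by simp))
      (fun h => (hg u ⟨h, left_mem_arc u v⟩).2 (by simp))
    have e2 : v = q := by
      -- Reversing both arcs preserves the sign of the determinant.
      refine left_eq_of_overlap (p := q) (q := p) (u := v) (v := u) hpq.symm
        (fun h => hpq' (by rw [h, neg_neg])) (u₁ := v₂) (u₂ := v₁) (v₁ := u₂) (v₂ := u₁)
        (by rw [hv, add_comm]) (by rw [hu, add_comm]) (by rw [hxe, add_comm]) hx₂ hx₁ hd hc
        (by rw [hxe', add_comm]) (by linarith)
        (fun h => ?_) (fun h => ?_)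
      · rw [Sym2.eq_swap] at h ⊢
        exact (hg q ⟨mem_arc_of_mem (by simp), h⟩).1 (by simp)
      · rw [Sym2.eq_swap] at h ⊢
        exact (hg v ⟨h, mem_arc_of_mem (by simp)⟩).2 (by simp)
    rw [e1, e2]
  rcases hdet.lt_or_gt with h | h
  · rw [Sym2.eq_swap (a := u)] at hx' hxn' hg ⊢
    exact aux hv hu hx' hxn' hg (by linarith)
  · exact aux hu hv hx' hxn' hg h

/-- A functional that vanishes on the plane of `p`, `q` but not at `u` fixes the ratio of the two
coefficients of a common point. All common points are thus non-negative multiples of one vector, and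
a ray meets the sphere once. -/
theorem subsingleton_of_notMem_span {p q u v : S2}
    (hu : (u : E3) ∉ Submodule.span ℝ {(p : E3), (q : E3)}) :
    (arc s(p, q) ∩ arc s(u, v)).Subsingleton := by
  obtain ⟨φ, hφu, hφ⟩ := Submodule.exists_le_ker_of_notMem hu
  have hp : φ p = 0 := hφ (Submodule.subset_span (by simp))
  have hq : φ q = 0 := hφ (Submodule.subset_span (by simp))
  have key : ∀ x ∈ arc s(p, q) ∩ arc s(u, v), ∃ d : ℝ, 0 ≤ d ∧
      (x : E3) = d • ((v : E3) - (φ v / φ u) • (u : E3)) := by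
    rintro x ⟨h1, h2⟩
    obtain ⟨a, b, -, -, hab⟩ := mem_arc_mk.1 h1
    obtain ⟨c, d, -, hd, hcd⟩ := mem_arc_mk.1 h2
    have h0 : φ x = 0 := by rw [hab]; simp [hp, hq]
    rw [hcd, map_add, map_smul, map_smul, smul_eq_mul, smul_eq_mul] at h0
    have hc : c = -(d * (φ v / φ u)) := by
      field_simp
      linarith
    refine ⟨d, hd, ?_⟩
    rw [hcd, hc]
    module
  intro x hx y hy
  obtain ⟨d, hd, hxd⟩ := key x hx
  obtain ⟨d', hd', hyd⟩ := key y hy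
  have h : d' • (x : E3) = d • (y : E3) := by rw [hxd, hyd]; module
  refine (smul_eq_smul_S2 hd' hd h).2.resolve_left ?_
  rintro rfl
  have hn := norm_coe_S2 y
  rw [hyd, zero_smul, norm_zero] at hn
  exact zero_ne_one hn

/-- Arcs in different planes share at most one point. For coplanar arcs, `eq_of_overlap` leaves only
the vertices `p`, `q` as common points. Finiteness is what makes generic points available. -/
theorem Diagram.finite_arc_inter (K : Diagram) {e f : Sym2 S2} (he : e ∈ K.edges) (hf : f ∈ K.edges)
    (hef : e ≠ f) : (arc e ∩ arc f).Finite := by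
  induction e with | _ p q =>
  induction f with | _ u v =>
  by_cases hu : (u : E3) ∈ Submodule.span ℝ {(p : E3), (q : E3)}
  swap
  · exact (subsingleton_of_notMem_span hu).finite
  by_cases hv : (v : E3) ∈ Submodule.span ℝ {(p : E3), (q : E3)}
  swap
  · rw [Sym2.eq_swap (a := u)]
    exact (subsingleton_of_notMem_span hv).finite
  obtain ⟨u₁, u₂, hu⟩ := Submodule.mem_span_pair.1 hu
  obtain ⟨v₁, v₂, hv⟩ := Submodule.mem_span_pair.1 hv
  refine (Set.toFinite ({p, q} : Set S2)).subset fun x hx => ?_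
  by_contra hn
  have hn : x ∉ s(p, q) := by simpa using hn
  have hg := K.generic _ he _ hf hef
  exact hef (eq_of_overlap (K.nondegenerate p q he).1 (K.nondegenerate p q he).2
    (K.nondegenerate u v hf).1 (K.nondegenerate u v hf).2 hu.symm hv.symm hx.1 hn hx.2
    (fun h => hn ((hg x hx).2 h)) hg)

/-! ### Generic points. -/

/-- A non-empty open cone in 3-space contains a point of the sphere that avoids all planes spanned by
the pairs of points of a given finite set. -/
theorem exists_generic_point {V : Set S2} (hV : V.Finite) {U : Set E3} (hU : IsOpen U)
    (hne : U.Nonempty) (hcone : ∀ x ∈ U, ∀ a : ℝ, 0 < a → a • x ∈ U) :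
    ∃ c : S2, (c : E3) ∈ U ∧
      ∀ x ∈ V, ∀ y ∈ V, (c : E3) ∉ Submodule.span ℝ {(x : E3), (y : E3)} := by
  have key : ∀ W : Submodule ℝ E3, W ≠ ⊤ → IsOpen (W : Set E3)ᶜ ∧ Dense (W : Set E3)ᶜ := by
    intro W hW
    refine ⟨W.closed_of_finiteDimensional.isOpen_compl, ?_⟩
    rw [← interior_eq_empty_iff_dense_compl]
    by_contra h
    exact hW (Submodule.eq_top_of_nonempty_interior' W (Set.nonempty_iff_ne_empty.2 h))
  have htop : ∀ x y : E3, Submodule.span ℝ {x, y} ≠ ⊤ := by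
    intro x y h
    have h1 : Module.finrank ℝ (Submodule.span ℝ ({x, y} : Set E3)) = 3 := by
      rw [h, finrank_top]; simp
    have h2 := finrank_span_le_card (R := ℝ) ({x, y} : Set E3)
    have h3 : ({x, y} : Set E3).toFinset.card ≤ 2 := by
      rw [Set.toFinset_card]
      simpa [Set.ncard_eq_toFinset_card'] using Set.ncard_insert_le x {y}
    omega
  -- The zero subspace is avoided as well, so that the point found can be normalised; the cone and
  -- the planes are stable under positive scaling.
  have hbot : (⊥ : Submodule ℝ E3) ≠ ⊤ := bot_ne_top
  have hdense : Dense (⋂ xy ∈ V ×ˢ V,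
      ((Submodule.span ℝ {((xy : S2 × S2).1 : E3), (xy.2 : E3)} : Submodule ℝ E3) : Set E3)ᶜ) :=
    dense_biInter_of_isOpen (fun xy _ => (key _ (htop _ _)).1) (hV.prod hV).countable
      (fun xy _ => (key _ (htop _ _)).2)
  have hopen : IsOpen (U ∩ ((⊥ : Submodule ℝ E3) : Set E3)ᶜ) := hU.inter (key _ hbot).1
  obtain ⟨w, hw, hw'⟩ := hdense.inter_open_nonempty _ hopen
    ((key _ hbot).2.inter_open_nonempty U hU hne)
  have hw0 : w ≠ 0 := fun h => hw.2 (by simp [h])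
  have hpos : 0 < ‖w‖⁻¹ := inv_pos.2 (norm_pos_iff.2 hw0)
  refine ⟨⟨‖w‖⁻¹ • w, by simp [norm_smul, hw0]⟩, hcone w hw.1 _ hpos, fun x hx y hy h => ?_⟩
  have h1 := Set.mem_iInter₂.1 hw' (x, y) ⟨hx, hy⟩
  exact h1 ((Submodule.smul_mem_iff _ hpos.ne').1 h)

namespace Diagram

/-- The vertices of a diagram. -/
def vertices (K : Diagram) : Set S2 := {x | ∃ e ∈ K.edges, x ∈ e}

/-- The points of a diagram that lie on two edges. -/
def doublePoints (K : Diagram) : Set S2 :=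
  {x | ∃ e ∈ K.edges, ∃ f ∈ K.edges, e ≠ f ∧ x ∈ arc e ∩ arc f}

theorem finite_vertices (K : Diagram) : K.vertices.Finite := by
  have : K.vertices = ⋃ e ∈ K.edges, {x | x ∈ e} := by
    ext x; simp [vertices]
  rw [this]
  refine K.finite_edges.biUnion fun e _ => ?_
  induction e with | _ p q =>
  exact (Set.toFinite ({p, q} : Set S2)).subset fun x hx => by simpa using hx

theorem finite_doublePoints (K : Diagram) : K.doublePoints.Finite := by
  have : K.doublePoints = ⋃ e ∈ K.edges, ⋃ f ∈ {f ∈ K.edges | e ≠ f}, arc e ∩ arc f := by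
    ext x
    simp only [doublePoints, Set.mem_ofPred_eq, Set.mem_iUnion, exists_prop]
    exact ⟨fun ⟨e, he, f, hf, h, hx⟩ => ⟨e, he, f, ⟨hf, h⟩, hx⟩,
      fun ⟨e, he, f, ⟨hf, h⟩, hx⟩ => ⟨e, he, f, hf, h, hx⟩⟩
  rw [this]
  exact K.finite_edges.biUnion fun e he =>
    (K.finite_edges.subset (Set.sep_subset _ _)).biUnion fun f hf =>
      K.finite_arc_inter he hf.1 hf.2

theorem endpoints_subset_vertices (K : Diagram) : K.endpoints ⊆ K.vertices :=
  fun _ ⟨e, he, _⟩ => ⟨e, he.1, he.2⟩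

/-- The point `c` lies on no plane spanned by two vertices or double points of the diagram. -/
def GenericPoint (K : Diagram) (c : S2) : Prop :=
  ∀ x ∈ K.vertices ∪ K.doublePoints, ∀ y ∈ K.vertices ∪ K.doublePoints,
    (c : E3) ∉ Submodule.span ℝ {(x : E3), (y : E3)}

/-- In an open cone there is a point that is generic for two given diagrams. -/
theorem exists_genericPoint (K K' : Diagram) {U : Set E3} (hU : IsOpen U)
    (hne : U.Nonempty) (hcone : ∀ x ∈ U, ∀ a : ℝ, 0 < a → a • x ∈ U) :
    ∃ c : S2, (c : E3) ∈ U ∧ K.GenericPoint c ∧ K'.GenericPoint c := by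
  obtain ⟨c, hcU, hc⟩ := exists_generic_point
    ((K.finite_vertices.union K.finite_doublePoints).union
      (K'.finite_vertices.union K'.finite_doublePoints)) hU hne hcone
  exact ⟨c, hcU, fun x hx y hy => hc x (Or.inl hx) y (Or.inl hy),
    fun x hx y hy => hc x (Or.inr hx) y (Or.inr hy)⟩

section GenericPoint

variable {K : Diagram} {c : S2}

theorem GenericPoint.notMem_arc (hc : K.GenericPoint c) {e : Sym2 S2} (he : e ∈ K.edges) :
    c ∉ arc e := by
  induction e with | _ u v =>
  intro h
  obtain ⟨a, b, -, -, hab⟩ := mem_arc_mk.1 h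
  refine hc u (Or.inl ⟨_, he, by simp⟩) v (Or.inl ⟨_, he, by simp⟩) ?_
  exact Submodule.mem_span_pair.2 ⟨a, b, hab.symm⟩

theorem GenericPoint.notMem_vertices (hc : K.GenericPoint c) : c ∉ K.vertices :=
  fun ⟨_, he, h⟩ => hc.notMem_arc he (mem_arc_of_mem h)

theorem GenericPoint.notMem_edge (hc : K.GenericPoint c) {e : Sym2 S2} (he : e ∈ K.edges) :
    c ∉ e := fun h => hc.notMem_vertices ⟨e, he, h⟩

theorem GenericPoint.edge_notMem (hc : K.GenericPoint c) (P : S2) : s(P, c) ∉ K.edges :=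
  fun h => hc.notMem_edge h (by simp)

/-- An arc from a vertex to a generic point contains no other vertex and no other double point. -/
theorem GenericPoint.eq_of_mem_arc (hc : K.GenericPoint c) {P x : S2} (hP : P ∈ K.vertices)
    (hx : x ∈ K.vertices ∪ K.doublePoints) (h : x ∈ arc s(P, c)) : x = P := by
  obtain ⟨a, b, ha, hb, hab⟩ := mem_arc_mk.1 h
  by_cases hb0 : b = 0
  · exact eq_of_coe_eq_smul ha (by simpa [hb0] using hab)
  · refine absurd ?_ (hc x hx P (Or.inl hP))
    refine Submodule.mem_span_pair.2 ⟨b⁻¹, -(b⁻¹ * a), ?_⟩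
    rw [hab, smul_add, smul_smul, smul_smul, inv_mul_cancel₀ hb0]
    module

/-- Two arcs from different vertices to a generic point meet only there. -/
theorem GenericPoint.eq_of_mem_arc_of_mem_arc (hc : K.GenericPoint c) {P Q x : S2}
    (hP : P ∈ K.vertices) (hQ : Q ∈ K.vertices) (hPQ : P ≠ Q) (h : x ∈ arc s(P, c))
    (h' : x ∈ arc s(Q, c)) : x = c := by
  obtain ⟨a, b, ha, hb, hab⟩ := mem_arc_mk.1 h
  obtain ⟨a', b', ha', hb', hab'⟩ := mem_arc_mk.1 h'
  -- Genericity of `c` with respect to the plane of `P`, `Q` forces `b = b'`; then `P ≠ Q` forces `a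
  -- = 0`.
  have heq : (b - b') • (c : E3) = a' • (Q : E3) - a • (P : E3) := by
    have := hab.symm.trans hab'
    rw [sub_smul, sub_eq_sub_iff_add_eq_add, add_comm, this]
  by_cases hbb : b = b'
  · rw [hbb, sub_self, zero_smul] at heq
    have h0 := smul_eq_smul_S2 ha ha' (sub_eq_zero.1 heq.symm).symm
    have ha0 : a = 0 := h0.2.resolve_right hPQ
    exact eq_of_coe_eq_smul hb (by simpa [ha0] using hab)
  · refine absurd ?_ (hc P (Or.inl hP) Q (Or.inl hQ))
    have hb0 : b - b' ≠ 0 := sub_ne_zero.2 hbb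
    refine Submodule.mem_span_pair.2 ⟨-((b - b')⁻¹ * a), (b - b')⁻¹ * a', ?_⟩
    have : (c : E3) = (b - b')⁻¹ • (a' • (Q : E3) - a • (P : E3)) := by
      rw [← heq, smul_smul, inv_mul_cancel₀ hb0, one_smul]
    rw [this]
    module

end GenericPoint

/-! ### Joining two endpoints by a virtual path through a generic point. -/

/-- An arc through an endpoint ends there. -/
theorem mem_of_endpoint_mem_arc {K : Diagram} {P : S2} (hP : P ∈ K.endpoints) {e : Sym2 S2}
    (he : e ∈ K.edges) (h : P ∈ arc e) : P ∈ e := by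
  obtain ⟨e₀, ⟨he₀, hPe₀⟩, -⟩ := hP
  by_cases hee : e = e₀
  · rwa [hee]
  · exact (K.generic e he e₀ he₀ hee P ⟨h, mem_arc_of_mem hPe₀⟩).2 hPe₀

theorem edge_unique_of_endpoint {K : Diagram} {P : S2} (hP : P ∈ K.endpoints) {e f : Sym2 S2}
    (he : e ∈ K.edges) (hf : f ∈ K.edges) (h : P ∈ arc e) (h' : P ∈ arc f) : e = f :=
  hP.unique ⟨he, mem_of_endpoint_mem_arc hP he h⟩ ⟨hf, mem_of_endpoint_mem_arc hP hf h'⟩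

theorem generic_edge_spoke {K : Diagram} {c P : S2} (hc : K.GenericPoint c) (hP : P ∈ K.endpoints)
    {e : Sym2 S2} (he : e ∈ K.edges) {x : S2} (h : x ∈ arc e) (h' : x ∈ arc s(P, c)) :
    x ∈ e ↔ x ∈ s(P, c) := by
  constructor
  · intro hx
    simp [hc.eq_of_mem_arc (K.endpoints_subset_vertices hP) (Or.inl ⟨e, he, hx⟩) h']
  · intro hx
    rcases Sym2.mem_iff.1 hx with rfl | rfl
    · exact mem_of_endpoint_mem_arc hP he h
    · exact absurd h (hc.notMem_arc he)

/-- A diagram together with a virtual path `P c Q` that joins two of its endpoints by way of a generic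
point `c`. -/
def addPath (K : Diagram) {P Q c : S2} (hP : P ∈ K.endpoints) (hQ : Q ∈ K.endpoints) (hPQ : P ≠ Q)
    (hc : K.GenericPoint c) : Diagram where
  edges := K.edges ∪ {s(P, c), s(Q, c)}
  finite_edges := K.finite_edges.union (Set.toFinite _)
  nondegenerate := by
    have aux : ∀ R ∈ K.endpoints, R ≠ c ∧ R ≠ -c ∧ c ≠ -R := by
      intro R hR
      have hR' : R ∈ K.vertices ∪ K.doublePoints := Or.inl (K.endpoints_subset_vertices hR)
      have h := hc R hR' R hR'
      refine ⟨?_, ?_, ?_⟩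
      · rintro rfl
        exact h (Submodule.subset_span (by simp))
      · rintro rfl
        refine h (Submodule.mem_span_pair.2 ⟨-1, 0, by simp⟩)
      · rintro rfl
        refine h (Submodule.mem_span_pair.2 ⟨-1, 0, by simp⟩)
    rintro p q (h | h | h)
    · exact K.nondegenerate p q h
    · rcases Sym2.eq_iff.1 h with ⟨rfl, rfl⟩ | ⟨rfl, rfl⟩
      · exact ⟨(aux _ hP).1, (aux _ hP).2.1⟩
      · exact ⟨(aux _ hP).1.symm, (aux _ hP).2.2⟩
    · rcases Sym2.eq_iff.1 h with ⟨rfl, rfl⟩ | ⟨rfl, rfl⟩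
      · exact ⟨(aux _ hQ).1, (aux _ hQ).2.1⟩
      · exact ⟨(aux _ hQ).1.symm, (aux _ hQ).2.2⟩
  generic := by
    have aux : ∀ x ∈ arc s(P, c) ∩ arc s(Q, c), (x ∈ s(P, c) ↔ x ∈ s(Q, c)) := by
      rintro x ⟨h, h'⟩
      simp [hc.eq_of_mem_arc_of_mem_arc (K.endpoints_subset_vertices hP)
        (K.endpoints_subset_vertices hQ) hPQ h h']
    rintro e (he | rfl | rfl) f (hf | rfl | rfl) hef x hx
    · exact K.generic e he f hf hef x hx
    · exact generic_edge_spoke hc hP he hx.1 hx.2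
    · exact generic_edge_spoke hc hQ he hx.1 hx.2
    · exact (generic_edge_spoke hc hP hf hx.2 hx.1).symm
    · exact absurd rfl hef
    · exact aux x hx
    · exact (generic_edge_spoke hc hQ hf hx.2 hx.1).symm
    · exact (aux x hx.symm).symm
    · exact absurd rfl hef
  no_triple := by
    -- A double point of `K` on a new edge could only be its endpoint `R`, but `R` lies on a single
    -- edge of `K`.
    have aux₁ : ∀ e ∈ K.edges, ∀ f ∈ K.edges, e ≠ f → ∀ R ∈ K.endpoints, ∀ x, x ∈ arc e →
        x ∈ arc f → x ∉ arc s(R, c) := by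
      intro e he f hf hef R hR x hxe hxf hx
      have := hc.eq_of_mem_arc (K.endpoints_subset_vertices hR)
        (Or.inr ⟨e, he, f, hf, hef, hxe, hxf⟩) hx
      subst this
      exact hef (edge_unique_of_endpoint hR he hf hxe hxf)
    -- The two new edges meet only in `c`, which lies on no edge of `K`.
    have aux₂ : ∀ e ∈ K.edges, ∀ x, x ∈ arc e → x ∈ arc s(P, c) → x ∉ arc s(Q, c) := by
      intro e he x hxe hx hx'
      have := hc.eq_of_mem_arc_of_mem_arc (K.endpoints_subset_vertices hP)
        (K.endpoints_subset_vertices hQ) hPQ hx hx'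
      subst this
      exact hc.notMem_arc he hxe
    intro e he f hf g hg hef hfg heg
    rw [Set.eq_empty_iff_forall_notMem]
    rintro x ⟨⟨hxe, hxf⟩, hxg⟩
    have hK := fun he hf hg => Set.eq_empty_iff_forall_notMem.1
      (K.no_triple e he f hf g hg hef hfg heg) x
    rcases he with he | rfl | rfl <;> rcases hf with hf | rfl | rfl <;>
      rcases hg with hg | rfl | rfl <;>
      first
      | exact absurd rfl hef
      | exact absurd rfl hfg
      | exact absurd rfl heg
      | exact hK he hf hg ⟨⟨hxe, hxf⟩, hxg⟩
      | exact aux₁ e he f hf hef P hP x hxe hxf hxg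
      | exact aux₁ e he f hf hef Q hQ x hxe hxf hxg
      | exact aux₁ e he g hg heg P hP x hxe hxg hxf
      | exact aux₁ e he g hg heg Q hQ x hxe hxg hxf
      | exact aux₁ f hf g hg hfg P hP x hxf hxg hxe
      | exact aux₁ f hf g hg hfg Q hQ x hxf hxg hxe
      | exact aux₂ e he x hxe hxf hxg
      | exact aux₂ e he x hxe hxg hxf
      | exact aux₂ f hf x hxf hxe hxg
      | exact aux₂ f hf x hxf hxg hxe
      | exact aux₂ g hg x hxg hxe hxf
      | exact aux₂ g hg x hxg hxf hxe
  isOver := K.isOver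
  crosses_of_isOver := fun e f h =>
    have h' := K.crosses_of_isOver e f h
    ⟨Or.inl h'.1, Or.inl h'.2.1, h'.2.2⟩
  isOver_asymm := K.isOver_asymm

section addPath

variable (K : Diagram) {P Q c : S2} (hP : P ∈ K.endpoints) (hQ : Q ∈ K.endpoints) (hPQ : P ≠ Q)
  (hc : K.GenericPoint c)

@[simp] theorem addPath_edges : (K.addPath hP hQ hPQ hc).edges = K.edges ∪ {s(P, c), s(Q, c)} := rfl

theorem addPath_endpoints : (K.addPath hP hQ hPQ hc).endpoints = K.endpoints \ {P, Q} := by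
  have hne : s(P, c) ≠ s(Q, c) := fun h => hPQ (Sym2.congr_left.1 h)
  have aux : ∀ R ∈ K.endpoints, s(R, c) ∈ (K.addPath hP hQ hPQ hc).edges →
      R ∉ (K.addPath hP hQ hPQ hc).endpoints := by
    intro R hR hRe h
    obtain ⟨e, he, -⟩ := hR
    have := h.unique ⟨Or.inl he.1, he.2⟩ ⟨hRe, by simp⟩
    exact hc.edge_notMem R (this ▸ he.1)
  ext x
  constructor
  · intro hx
    have hxP : x ≠ P := by
      rintro rfl; exact aux _ hP (by simp) hx
    have hxQ : x ≠ Q := by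
      rintro rfl; exact aux _ hQ (by simp) hx
    have hxc : x ≠ c := by
      rintro rfl
      exact hne (hx.unique ⟨by simp, by simp⟩ ⟨by simp, by simp⟩)
    refine ⟨?_, by simp [hxP, hxQ]⟩
    obtain ⟨e, ⟨he, hxe⟩, huniq⟩ := hx
    rcases he with he | rfl | rfl
    · exact ⟨e, ⟨he, hxe⟩, fun f hf => huniq f ⟨Or.inl hf.1, hf.2⟩⟩
    · simp [hxP, hxc] at hxe
    · simp [hxQ, hxc] at hxe
  · rintro ⟨hx, hxPQ⟩
    simp only [Set.mem_insert_iff, Set.mem_singleton_iff, not_or] at hxPQ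
    have hxc : x ≠ c := by
      rintro rfl
      exact hc.notMem_vertices (K.endpoints_subset_vertices hx)
    obtain ⟨e, ⟨he, hxe⟩, huniq⟩ := hx
    refine ⟨e, ⟨Or.inl he, hxe⟩, ?_⟩
    rintro f ⟨hf | rfl | rfl, hxf⟩
    · exact huniq f ⟨hf, hxf⟩
    · simp [hxPQ.1, hxc] at hxf
    · simp [hxPQ.2, hxc] at hxf

end addPath

/-- A path of two edges. -/
theorem isPathBetween_pair {P Q c : S2} (hPQ : P ≠ Q) (hP : P ≠ c) (hQ : Q ≠ c) :
    IsPathBetween {s(P, c), s(Q, c)} P Q := by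
  have h₁ : (SimpleGraph.fromEdgeSet ({s(P, c), s(Q, c)} : Set (Sym2 S2))).Adj P c := by
    simp [hP]
  have h₂ : (SimpleGraph.fromEdgeSet ({s(P, c), s(Q, c)} : Set (Sym2 S2))).Adj c Q := by
    simp [hQ.symm, Sym2.eq_swap]
  refine ⟨.cons h₁ (.cons h₂ .nil), ?_, ?_⟩
  · simp [SimpleGraph.Walk.cons_isPath_iff, hPQ, hP, hQ.symm]
  · ext e
    simp [Sym2.eq_swap (a := Q)]

end Diagram

open Diagram

/-! ### Paths, extensionality of diagrams, and closure permutations. -/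

/-- An inner vertex of a path lies on two different edges of the path. -/
theorem exists_two_edges_of_isPath {V : Type*} {G : SimpleGraph V} {p q : V} (w : G.Walk p q)
    (hw : w.IsPath) {x : V} (hx : x ∈ w.support) (hxp : x ≠ p) (hxq : x ≠ q) :
    ∃ e ∈ w.edges, ∃ f ∈ w.edges, e ≠ f ∧ x ∈ e ∧ x ∈ f := by
  induction w with
  | nil => exact absurd (by simpa using hx) hxp
  | @cons u v z h w ih =>
    rw [SimpleGraph.Walk.cons_isPath_iff] at hw
    have hx : x ∈ w.support := by simpa [hxp] using hx
    by_cases hxv : x = v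
    · subst hxv
      cases w with
      | nil => exact absurd rfl hxq
      | @cons _ y _ h' w' =>
        refine ⟨s(u, x), by simp, s(x, y), by simp, fun heq => ?_, by simp, by simp⟩
        have hu : u ∈ s(x, y) := heq ▸ Sym2.mem_mk_left u x
        apply hw.2
        rcases Sym2.mem_iff.1 hu with rfl | rfl
        · exact absurd rfl h.ne
        · simp
    · obtain ⟨e, he, f, hf, hef⟩ := ih hw.1 hx hxv hxq
      exact ⟨e, by simp [he], f, by simp [hf], hef⟩

theorem Diagram.IsPathBetween.exists_two_edges {A : Set (Sym2 S2)} {p q x : S2} (h : IsPathBetween A p q)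
    {e : Sym2 S2} (he : e ∈ A) (hx : x ∈ e) (hxp : x ≠ p) (hxq : x ≠ q) :
    ∃ e ∈ A, ∃ f ∈ A, e ≠ f ∧ x ∈ e ∧ x ∈ f := by
  obtain ⟨w, hw, hwA⟩ := h
  have hmem : ∀ f, f ∈ A ↔ f ∈ w.edges := fun f => (Set.ext_iff.1 hwA f).symm
  have hxw : x ∈ w.support := by
    obtain ⟨y, rfl⟩ := hx
    exact w.fst_mem_support_of_mem_edges ((hmem _).1 he)
  obtain ⟨e, he, f, hf, hef⟩ := exists_two_edges_of_isPath w hw hxw hxp hxq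
  exact ⟨e, (hmem e).2 he, f, (hmem f).2 hf, hef⟩

theorem Diagram.IsPathBetween.symm {A : Set (Sym2 S2)} {p q : S2} (h : IsPathBetween A p q) :
    IsPathBetween A q p := by
  obtain ⟨w, hw, hwA⟩ := h
  refine ⟨w.reverse, hw.reverse, ?_⟩
  simpa using hwA

theorem Diagram.IsPathBetween.exists_first_edge {A : Set (Sym2 S2)} {p q : S2} (h : IsPathBetween A p q)
    (hpq : p ≠ q) : ∃ e ∈ A, p ∈ e := by
  obtain ⟨w, -, hwA⟩ := h
  cases w with
  | nil => exact absurd rfl hpq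
  | @cons _ v _ h w => exact ⟨s(p, v), (Set.ext_iff.1 hwA _).1 (by simp), by simp⟩

/-- The part of a diagram formed by a set of edges that contains all classical crossings. -/
def Diagram.restrict (D : Diagram) (E : Set (Sym2 S2)) (hE : E ⊆ D.edges)
    (hover : ∀ e f, D.isOver e f → e ∈ E ∧ f ∈ E) : Diagram where
  edges := E
  finite_edges := D.finite_edges.subset hE
  nondegenerate := fun p q h => D.nondegenerate p q (hE h)
  generic := fun e he f hf => D.generic e (hE he) f (hE hf)
  no_triple := fun e he f hf g hg => D.no_triple e (hE he) f (hE hf) g (hE hg)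
  isOver := D.isOver
  crosses_of_isOver := fun e f h =>
    ⟨(hover e f h).1, (hover e f h).2, (D.crosses_of_isOver e f h).2.2⟩
  isOver_asymm := D.isOver_asymm

theorem Diagram.eq_of_edges_of_isOver {D D' : Diagram} (h : D.edges = D'.edges)
    (h' : ∀ e f, D.isOver e f ↔ D'.isOver e f) : D = D' := by
  have h'' : D.isOver = D'.isOver := by
    funext e f
    exact propext (h' e f)
  cases D
  cases D'
  cases h
  cases h''
  rfl

theorem VirtualLinkDiagram.eq_of_edges_of_isOver {D D' : VirtualLinkDiagram} (h : D.edges = D'.edges)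
    (h' : ∀ e f, D.isOver e f ↔ D'.isOver e f) : D = D' := by
  have h'' := Diagram.eq_of_edges_of_isOver h h'
  cases D
  cases D'
  cases h''
  rfl

theorem VirtualMove.toLink_eq {D D' : VirtualLinkDiagram} (h : VirtualMove D D') :
    D.toLink = D'.toLink :=
  Quotient.sound (Relation.EqvGen.rel _ _ h)

theorem map_eq_or_iff {n : ℕ} {σ : Equiv.Perm (Fin (2 * n))} (hσ : σ ∈ closurePermutations n)
    (i j : Fin (2 * n)) : (σ j = i ∨ σ j = σ i) ↔ (j = i ∨ j = σ i) := by
  rw [σ.injective.eq_iff, or_comm]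
  refine or_congr_right ⟨fun h => ?_, fun h => ?_⟩
  · rw [← h, (hσ j).1]
  · rw [h, (hσ i).1]

theorem LinkoidDiagram.endpoints_eq_range {n : ℕ} (L : LinkoidDiagram n) (l : L.Labelling) :
    L.endpoints = Set.range fun i => (l i : S2) := by
  ext x
  exact ⟨fun hx => ⟨l.symm ⟨x, hx⟩, by simp⟩, by rintro ⟨i, rfl⟩; exact (l i).2⟩

/-! ### Existence of virtual closures, simultaneously for two diagrams with the same endpoints. -/

section Existence

variable {n : ℕ} {σ : Equiv.Perm (Fin (2 * n))}

/-- The diagram `M` consists of `K` and of virtual edges from the endpoints `l i`, `i ∈ S`, of `K` to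
points `c i`, so that the remaining endpoints are the points `l i`, `i ∉ S`. -/
structure IsPartialClosure (K : Diagram) (l c : Fin (2 * n) → S2) (S : Set (Fin (2 * n)))
    (M : Diagram) : Prop where
  edges_eq : M.edges = K.edges ∪ (fun i => s(l i, c i)) '' S
  isOver_eq : M.isOver = K.isOver
  endpoints_eq : M.endpoints = l '' Sᶜ
  notMem : ∀ i ∈ S, s(l i, c i) ∉ K.edges
  ne : ∀ i ∈ S, ∀ j, c i ≠ l j

/-- The inductive step: one more pair is closed. The point `c₀` has to be generic for `M`, not only
for `K`, because the new path must also be in general position to the arcs added before. -/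
theorem IsPartialClosure.insert {K M : Diagram} {l c : Fin (2 * n) → S2} {S : Set (Fin (2 * n))}
    (hM : IsPartialClosure K l c S M) (hσ : σ ∈ closurePermutations n) (hl : l.Injective)
    (hK : K.endpoints = Set.range l) {i : Fin (2 * n)} (hi : i ∉ S) (hi' : σ i ∉ S) {c₀ : S2}
    (hc : M.GenericPoint c₀) :
    ∃ M', IsPartialClosure K l (fun j => if j = i ∨ j = σ i then c₀ else c j)
      (insert i (insert (σ i) S)) M' := by
  have hP : l i ∈ M.endpoints := by rw [hM.endpoints_eq]; exact ⟨i, hi, rfl⟩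
  have hQ : l (σ i) ∈ M.endpoints := by rw [hM.endpoints_eq]; exact ⟨_, hi', rfl⟩
  have hPQ : l i ≠ l (σ i) := fun h => (hσ i).2 (hl h).symm
  have hS : ∀ j ∈ S, ¬(j = i ∨ j = σ i) := by
    rintro j hj (rfl | rfl)
    · exact hi hj
    · exact hi' hj
  have hKM : K.edges ⊆ M.edges := by rw [hM.edges_eq]; exact Set.subset_union_left
  have hcl : ∀ j, c₀ ≠ l j := by
    rintro j rfl
    have : l j ∈ K.endpoints := by rw [hK]; exact ⟨j, rfl⟩
    obtain ⟨e, he, hle⟩ := K.endpoints_subset_vertices this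
    exact hc.notMem_vertices ⟨e, hKM he, hle⟩
  refine ⟨M.addPath hP hQ hPQ hc, ?_, hM.isOver_eq, ?_, ?_, ?_⟩
  · have himg : (fun j => s(l j, if j = i ∨ j = σ i then c₀ else c j)) '' S
        = (fun j => s(l j, c j)) '' S :=
      Set.image_congr fun j hj => by simp only [if_neg (hS j hj)]
    rw [addPath_edges, hM.edges_eq, Set.image_insert_eq, Set.image_insert_eq, himg]
    ext e
    simp only [true_or, or_true, if_true, Set.mem_union, Set.mem_insert_iff, Set.mem_singleton_iff]
    tauto
  · rw [addPath_endpoints, hM.endpoints_eq]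
    have : (Insert.insert i (Insert.insert (σ i) S))ᶜ = Sᶜ \ {i, σ i} := by
      ext j
      simp only [Set.mem_compl_iff, Set.mem_insert_iff, Set.mem_sdiff, Set.mem_singleton_iff]
      tauto
    rw [this, Set.image_sdiff hl, Set.image_pair]
  · rintro j (rfl | rfl | hj)
    · simpa using fun h => hc.edge_notMem _ (hKM h)
    · simpa using fun h => hc.edge_notMem _ (hKM h)
    · simpa [hS j hj] using hM.notMem j hj
  · rintro j (rfl | rfl | hj)
    · simpa using hcl
    · simpa using hcl
    · simpa [hS j hj] using hM.ne j hj

/-- Two diagrams with the same endpoints can be closed by the same virtual arcs, whose inner vertices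
lie in a given open cone. -/
theorem exists_common_partialClosure (hσ : σ ∈ closurePermutations n) {K K' : Diagram}
    {l : Fin (2 * n) → S2} (hl : l.Injective) (hK : K.endpoints = Set.range l)
    (hK' : K'.endpoints = Set.range l) {U : Set E3} (hU : IsOpen U)
    (hne : U.Nonempty) (hcone : ∀ x ∈ U, ∀ a : ℝ, 0 < a → a • x ∈ U) :
    ∃ c : Fin (2 * n) → S2, (∀ i, c (σ i) = c i) ∧ (∀ i, (c i : E3) ∈ U) ∧
      (∃ M, IsPartialClosure K l c Set.univ M) ∧ ∃ M', IsPartialClosure K' l c Set.univ M' := by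
  -- The set `S` of treated labels is kept `σ`-stable and may exceed `s`, since labels are treated
  -- in pairs `i`, `σ i`. Values of `c` outside `S` are placeholders.
  have key : ∀ s : Finset (Fin (2 * n)), ∃ S : Set (Fin (2 * n)), ↑s ⊆ S ∧
      (∀ j, σ j ∈ S ↔ j ∈ S) ∧ ∃ c : Fin (2 * n) → S2, (∀ i, c (σ i) = c i) ∧
      (∀ i ∈ S, (c i : E3) ∈ U) ∧
      (∃ M, IsPartialClosure K l c S M) ∧ ∃ M', IsPartialClosure K' l c S M' := by
    intro s
    induction s using Finset.induction_on with
    | empty =>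
      obtain ⟨c₀, -⟩ := exists_genericPoint K K' hU hne hcone
      exact ⟨∅, by simp, by simp, fun _ => c₀, by simp, by simp,
        ⟨K, by simp, rfl, by simp [hK], by simp, by simp⟩,
        ⟨K', by simp, rfl, by simp [hK'], by simp, by simp⟩⟩
    | insert i s _ ih =>
      obtain ⟨S, hsS, hSσ, c, hcσ, hcU, ⟨M, hM⟩, ⟨M', hM'⟩⟩ := ih
      by_cases hi : i ∈ S
      · refine ⟨S, ?_, hSσ, c, hcσ, hcU, ⟨M, hM⟩, ⟨M', hM'⟩⟩
        rw [Finset.coe_insert]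
        exact Set.insert_subset hi hsS
      have hi' : σ i ∉ S := fun h => hi ((hSσ i).1 h)
      obtain ⟨c₀, hc₀, hcM, hcM'⟩ := exists_genericPoint M M' hU hne hcone
      have hsw := map_eq_or_iff hσ i
      refine ⟨insert i (insert (σ i) S), ?_, ?_,
        fun j => if j = i ∨ j = σ i then c₀ else c j, ?_, ?_,
        hM.insert hσ hl hK hi hi' hcM, hM'.insert hσ hl hK' hi hi' hcM'⟩
      · rw [Finset.coe_insert]
        exact Set.insert_subset_insert (hsS.trans (Set.subset_insert _ _))
      · intro j
        simp only [Set.mem_insert_iff, hSσ, ← or_assoc, hsw]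
      · intro j
        simp only [hsw, hcσ]
      · intro j hj
        by_cases h : j = i ∨ j = σ i
        · simp [h, hc₀]
        · simp only [if_neg h]
          rcases hj with hj | hj | hj
          · exact absurd (Or.inl hj) h
          · exact absurd (Or.inr hj) h
          · exact hcU j hj
  obtain ⟨S, hS, -, c, hcσ, hcU, hM⟩ := key Finset.univ
  have : S = Set.univ := Set.eq_univ_of_univ_subset (by simpa using hS)
  subst this
  exact ⟨c, hcσ, fun i => hcU i trivial, hM⟩

/-- The virtual link diagram given by a complete closure. -/
def IsPartialClosure.toVirtualLinkDiagram {K M : Diagram} {l c : Fin (2 * n) → S2}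
    (hM : IsPartialClosure K l c Set.univ M) : VirtualLinkDiagram :=
  ⟨M, by simp [hM.endpoints_eq]⟩

theorem IsPartialClosure.isClosureDiagram {L : LinkoidDiagram n} {l : L.Labelling} {M : Diagram}
    {c : Fin (2 * n) → S2} (hM : IsPartialClosure L.toDiagram (fun i => (l i : S2)) c Set.univ M)
    (hσ : σ ∈ closurePermutations n) (hcσ : ∀ i, c (σ i) = c i) :
    IsClosureDiagram L l σ hM.toVirtualLinkDiagram := by
  have hl : ∀ i j, (l i : S2) = l j → i = j := fun i j h => l.injective (Subtype.ext h)
  -- No `c i` is an endpoint, so an edge determines its label even if some of the points `c i`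
  -- coincide.
  have hinj : ∀ i j, s((l i : S2), c i) = s((l j : S2), c j) → i = j := by
    intro i j h
    rcases Sym2.eq_iff.1 h with h | h
    · exact hl i j h.1
    · exact absurd h.2 (hM.ne i trivial j)
  refine ⟨fun i => {s((l i : S2), c i), s((l (σ i) : S2), c (σ i))}, ?_, ?_, ?_, ?_, ?_, ?_⟩
  · intro i
    simp only [hcσ]
    exact isPathBetween_pair (fun h => (hσ i).2 (hl _ _ h).symm) (hM.ne i trivial i).symm
      (hM.ne i trivial (σ i)).symm
  · intro i
    simp only [(hσ i).1]
    exact Set.pair_comm _ _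
  · intro i j hij hij'
    have h₁ : σ j ≠ i := by rintro rfl; exact hij' (hσ j).1.symm
    have h₂ : σ j ≠ σ i := fun h => hij (σ.injective h)
    rw [Set.disjoint_left]
    rintro e (rfl | rfl) (h | h)
    · exact hij (hinj _ _ h).symm
    · exact h₁ (hinj _ _ h).symm
    · exact hij' (hinj _ _ h).symm
    · exact h₂ (hinj _ _ h).symm
  · intro i
    rw [Set.disjoint_right]
    rintro e (rfl | rfl)
    · exact hM.notMem i trivial
    · exact hM.notMem (σ i) trivial
  · refine hM.edges_eq.trans ?_
    congr 1
    ext e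
    simp only [Set.image_univ, Set.mem_range, Set.mem_iUnion, Set.mem_insert_iff,
      Set.mem_singleton_iff]
    constructor
    · rintro ⟨i, rfl⟩
      exact ⟨i, Or.inl rfl⟩
    · rintro ⟨i, rfl | rfl⟩
      · exact ⟨i, rfl⟩
      · exact ⟨σ i, rfl⟩
  · intro e f
    exact iff_of_eq (congrFun (congrFun hM.isOver_eq e) f)

end Existence

/-! ### Uniqueness of virtual closures, by detour moves. -/

section Uniqueness

variable {n : ℕ} {L : LinkoidDiagram n} {l : L.Labelling} {σ : Equiv.Perm (Fin (2 * n))}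

/-- The sets `A i` are the closure arcs of the virtual closure diagram `D`. -/
structure IsClosureFamily (L : LinkoidDiagram n) (l : L.Labelling)
    (σ : Equiv.Perm (Fin (2 * n))) (A : Fin (2 * n) → Set (Sym2 S2)) (D : VirtualLinkDiagram) :
    Prop where
  path : ∀ i, IsPathBetween (A i) (l i) (l (σ i))
  symm : ∀ i, A (σ i) = A i
  disjoint : ∀ i j, j ≠ i → j ≠ σ i → Disjoint (A i) (A j)
  disjoint_edges : ∀ i, Disjoint L.edges (A i)
  edges_eq : D.edges = L.edges ∪ ⋃ i, A i
  isOver_iff : ∀ e f, D.isOver e f ↔ L.isOver e f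

theorem isClosureDiagram_iff {D : VirtualLinkDiagram} :
    IsClosureDiagram L l σ D ↔ ∃ A, IsClosureFamily L l σ A D :=
  ⟨fun ⟨A, h₁, h₂, h₃, h₄, h₅, h₆⟩ => ⟨A, h₁, h₂, h₃, h₄, h₅, h₆⟩,
    fun ⟨A, h⟩ => ⟨A, h.path, h.symm, h.disjoint, h.disjoint_edges, h.edges_eq, h.isOver_iff⟩⟩

variable {A : Fin (2 * n) → Set (Sym2 S2)} {D : VirtualLinkDiagram}

namespace IsClosureFamily

/-- All classical crossings are between edges of `L`; hence a closure arc can be removed without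
losing any, as `restrict` and the detour move require. -/
theorem mem_of_isOver (h : IsClosureFamily L l σ A D) (i : Fin (2 * n)) (e f : Sym2 S2)
    (hef : D.isOver e f) : e ∈ D.edges \ A i ∧ f ∈ D.edges \ A i := by
  have h₁ := D.crosses_of_isOver e f hef
  have h₂ := L.crosses_of_isOver e f ((h.isOver_iff e f).1 hef)
  exact ⟨⟨h₁.1, Set.disjoint_left.1 (h.disjoint_edges i) h₂.1⟩,
    ⟨h₁.2.1, Set.disjoint_left.1 (h.disjoint_edges i) h₂.2.1⟩⟩

/-- The diagram that arises by removing a closure arc. -/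
def removeArc (h : IsClosureFamily L l σ A D) (i : Fin (2 * n)) : Diagram :=
  D.restrict (D.edges \ A i) Set.sdiff_subset (h.mem_of_isOver i)

theorem arc_subset (h : IsClosureFamily L l σ A D) (i : Fin (2 * n)) : A i ⊆ D.edges := by
  rw [h.edges_eq]
  exact (Set.subset_iUnion A i).trans Set.subset_union_right

theorem edges_subset (h : IsClosureFamily L l σ A D) : L.edges ⊆ D.edges := by
  rw [h.edges_eq]
  exact Set.subset_union_left

theorem ne (hσ : σ ∈ closurePermutations n) (i : Fin (2 * n)) : (l i : S2) ≠ l (σ i) :=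
  fun h => (hσ i).2 (l.injective (Subtype.ext h)).symm

/-- In `D` the point `l i` lies on an edge of `L` and on one of `A i`, and a third edge would make
it a triple point. -/
theorem left_mem_endpoints (h : IsClosureFamily L l σ A D) (hσ : σ ∈ closurePermutations n)
    (i : Fin (2 * n)) : (l i : S2) ∈ (h.removeArc i).endpoints := by
  obtain ⟨e, ⟨he, hle⟩, -⟩ := (l i).2
  obtain ⟨f, hf, hlf⟩ := (h.path i).exists_first_edge (ne hσ i)
  have hef : e ≠ f := by
    rintro rfl
    exact Set.disjoint_left.1 (h.disjoint_edges i) he hf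
  refine ⟨e, ⟨⟨h.edges_subset he, Set.disjoint_left.1 (h.disjoint_edges i) he⟩, hle⟩, ?_⟩
  rintro g ⟨hg, hlg⟩
  by_contra hge
  have hgf : f ≠ g := by
    rintro rfl
    exact hg.2 hf
  exact Set.eq_empty_iff_forall_notMem.1 (D.no_triple e (h.edges_subset he) f (h.arc_subset i hf) g
    hg.1 hef hgf (Ne.symm hge)) _ ⟨⟨mem_arc_of_mem hle, mem_arc_of_mem hlf⟩, mem_arc_of_mem hlg⟩

theorem right_mem_endpoints (h : IsClosureFamily L l σ A D) (hσ : σ ∈ closurePermutations n)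
    (i : Fin (2 * n)) : (l (σ i) : S2) ∈ (h.removeArc i).endpoints := by
  have := h.left_mem_endpoints hσ (σ i)
  unfold removeArc at this ⊢
  simpa only [h.symm i] using this

/-- As `D` has no endpoints, a new one must lie on `A i`. An inner vertex of `A i` already lies on
two edges of that arc, so a remaining edge through it would create a triple point. -/
theorem endpoints_removeArc_subset (h : IsClosureFamily L l σ A D) (i : Fin (2 * n)) :
    (h.removeArc i).endpoints ⊆ {(l i : S2), (l (σ i) : S2)} := by
  intro x hx
  obtain ⟨e, ⟨he, hxe⟩, huniq⟩ := hx
  by_contra hn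
  simp only [Set.mem_insert_iff, Set.mem_singleton_iff, not_or] at hn
  have hxD : x ∉ D.endpoints := by simp [D.no_endpoints]
  have hf : ∃ f ∈ A i, x ∈ f := by
    by_contra hA
    push Not at hA
    exact hxD ⟨e, ⟨he.1, hxe⟩, fun f hf => huniq f ⟨⟨hf.1, fun hfA => hA f hfA hf.2⟩, hf.2⟩⟩
  obtain ⟨f, hfA, hxf⟩ := hf
  obtain ⟨f, hf, g, hg, hfg, hxf, hxg⟩ := (h.path i).exists_two_edges hfA hxf hn.1 hn.2
  have hef : e ≠ f := by rintro rfl; exact he.2 hf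
  have heg : e ≠ g := by rintro rfl; exact he.2 hg
  exact Set.eq_empty_iff_forall_notMem.1 (D.no_triple e he.1 f (h.arc_subset i hf) g
    (h.arc_subset i hg) hef hfg heg) x
    ⟨⟨mem_arc_of_mem hxe, mem_arc_of_mem hxf⟩, mem_arc_of_mem hxg⟩

/-- A closure arc may be replaced by an arc of two edges by way of a generic point. -/
theorem exists_replace (h : IsClosureFamily L l σ A D) (hσ : σ ∈ closurePermutations n)
    (i : Fin (2 * n)) {c : S2} (hc : (h.removeArc i).GenericPoint c) :
    ∃ D' : VirtualLinkDiagram, D'.toLink = D.toLink ∧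
      IsClosureFamily L l σ (fun j => if j = i ∨ j = σ i then
        {s((l i : S2), c), s((l (σ i) : S2), c)} else A j) D' := by
  have hP := h.left_mem_endpoints hσ i
  have hQ := h.right_mem_endpoints hσ i
  have hPQ : (l i : S2) ≠ l (σ i) := ne hσ i
  have hPc : (l i : S2) ≠ c := by
    rintro hcc
    exact hc.notMem_vertices (hcc ▸ (h.removeArc i).endpoints_subset_vertices hP)
  have hQc : (l (σ i) : S2) ≠ c := by
    rintro hcc
    exact hc.notMem_vertices (hcc ▸ (h.removeArc i).endpoints_subset_vertices hQ)
  have hB : ∀ e ∈ ({s((l i : S2), c), s((l (σ i) : S2), c)} : Set (Sym2 S2)), e ∉ D.edges \ A i := by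
    rintro e (rfl | rfl)
    · exact hc.edge_notMem _
    · exact hc.edge_notMem _
  have hLsub : L.edges ⊆ D.edges \ A i := fun e he =>
    ⟨h.edges_subset he, Set.disjoint_left.1 (h.disjoint_edges i) he⟩
  have hAsub : ∀ j, ¬(j = i ∨ j = σ i) → A j ⊆ D.edges \ A i := fun j hj e he =>
    ⟨h.arc_subset j he, Set.disjoint_right.1
      (h.disjoint i j (fun h => hj (Or.inl h)) (fun h => hj (Or.inr h))) he⟩
  have hsw := map_eq_or_iff hσ i
  have hpath := isPathBetween_pair hPQ hPc hQc
  refine ⟨⟨(h.removeArc i).addPath hP hQ hPQ hc, ?_⟩, ?_, ?_, ?_, ?_, ?_, ?_, ?_⟩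
  · rw [addPath_endpoints]
    exact Set.sdiff_eq_empty.2 (h.endpoints_removeArc_subset i)
  · refine (VirtualMove.toLink_eq (Or.inr (Or.inr (Or.inr (Or.inr ?_))))).symm
    refine ⟨D.edges \ A i, A i, {s((l i : S2), c), s((l (σ i) : S2), c)}, l i, l (σ i),
      Set.disjoint_sdiff_left, Set.disjoint_right.2 hB,
      (Set.sdiff_union_of_subset (h.arc_subset i)).symm, rfl, h.path i, hpath,
      h.mem_of_isOver i, fun e f => Iff.rfl⟩
  · intro j
    by_cases hj : j = i ∨ j = σ i
    · simp only [if_pos hj]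
      rcases hj with rfl | rfl
      · exact hpath
      · rw [(hσ i).1]
        exact hpath.symm
    · simp only [if_neg hj]
      exact h.path j
  · intro j
    simp only [hsw, h.symm]
  · intro j k hjk hjk'
    by_cases hj : j = i ∨ j = σ i
    · have hk : ¬(k = i ∨ k = σ i) := by
        rintro (rfl | rfl)
        · rcases hj with rfl | rfl
          · exact hjk rfl
          · exact hjk' (hσ _).1.symm
        · rcases hj with rfl | rfl
          · exact hjk' rfl
          · exact hjk rfl
      simp only [if_pos hj, if_neg hk]
      exact Set.disjoint_left.2 fun e he hk' => hB e he (hAsub k hk hk')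
    · by_cases hk : k = i ∨ k = σ i
      · simp only [if_pos hk, if_neg hj]
        exact Set.disjoint_right.2 fun e he hj' => hB e he (hAsub j hj hj')
      · simp only [if_neg hj, if_neg hk]
        exact h.disjoint j k hjk hjk'
  · intro j
    by_cases hj : j = i ∨ j = σ i
    · simp only [if_pos hj]
      exact Set.disjoint_right.2 fun e he he' => hB e he (hLsub he')
    · simp only [if_neg hj]
      exact h.disjoint_edges j
  · change D.edges \ A i ∪ {s((l i : S2), c), s((l (σ i) : S2), c)} = _
    ext e
    simp only [Set.mem_union, Set.mem_iUnion]
    constructor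
    · rintro (⟨he, hei⟩ | he)
      · rw [h.edges_eq] at he
        rcases he with he | he
        · exact Or.inl he
        · obtain ⟨j, hj⟩ := Set.mem_iUnion.1 he
          refine Or.inr ⟨j, ?_⟩
          rw [if_neg]
          · exact hj
          · rintro (rfl | rfl)
            · exact hei hj
            · exact hei (h.symm i ▸ hj)
      · exact Or.inr ⟨i, by simpa using he⟩
    · rintro (he | ⟨j, hj⟩)
      · exact Or.inl (hLsub he)
      · split_ifs at hj with hij
        · exact Or.inr hj
        · exact Or.inl (hAsub j hij hj)
  · exact h.isOver_iff

end IsClosureFamily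

/-- All virtual closure diagrams with respect to a closure permutation represent the same link. -/
theorem IsClosureDiagram.toLink_eq {D' : VirtualLinkDiagram} (hσ : σ ∈ closurePermutations n)
    (hD : IsClosureDiagram L l σ D) (hD' : IsClosureDiagram L l σ D') : D.toLink = D'.toLink := by
  obtain ⟨A, hA⟩ := isClosureDiagram_iff.1 hD
  obtain ⟨A', hA'⟩ := isClosureDiagram_iff.1 hD'
  have key : ∀ s : Finset (Fin (2 * n)), ∃ D₁ D₂ A₁ A₂, D₁.toLink = D.toLink ∧
      D₂.toLink = D'.toLink ∧ IsClosureFamily L l σ A₁ D₁ ∧ IsClosureFamily L l σ A₂ D₂ ∧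
      ∀ j ∈ s, A₁ j = A₂ j := by
    intro s
    induction s using Finset.induction_on with
    | empty => exact ⟨D, D', A, A', rfl, rfl, hA, hA', by simp⟩
    | insert i s _ ih =>
      obtain ⟨D₁, D₂, A₁, A₂, h₁, h₂, hA₁, hA₂, hs⟩ := ih
      obtain ⟨c, -, hc₁, hc₂⟩ := exists_genericPoint (hA₁.removeArc i) (hA₂.removeArc i)
        isOpen_univ Set.univ_nonempty (fun _ _ _ _ => trivial)
      obtain ⟨D₁', h₁', hA₁'⟩ := hA₁.exists_replace hσ i hc₁
      obtain ⟨D₂', h₂', hA₂'⟩ := hA₂.exists_replace hσ i hc₂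
      -- Both diagrams receive the same path through `c`; if an arc that already agreed is
      -- overwritten, it still agrees.
      refine ⟨D₁', D₂', _, _, h₁'.trans h₁, h₂'.trans h₂, hA₁', hA₂', fun j hj => ?_⟩
      by_cases hji : j = i ∨ j = σ i
      · simp only [if_pos hji]
      · simp only [if_neg hji]
        exact hs j ((Finset.mem_insert.1 hj).resolve_left fun h => hji (Or.inl h))
  obtain ⟨D₁, D₂, A₁, A₂, h₁, h₂, hA₁, hA₂, hs⟩ := key Finset.univ
  have hAA : A₁ = A₂ := funext fun j => hs j (Finset.mem_univ j)
  rw [← h₁, ← h₂]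
  congr 1
  apply VirtualLinkDiagram.eq_of_edges_of_isOver
  · rw [hA₁.edges_eq, hA₂.edges_eq, hAA]
  · intro e f
    rw [hA₁.isOver_iff, hA₂.isOver_iff]

end Uniqueness

/-- Virtual closures with respect to a closure permutation exist and are unique. -/
theorem existsUnique_isVirtualClosure {n : ℕ} (L : LinkoidDiagram n) (l : L.Labelling)
    {σ : Equiv.Perm (Fin (2 * n))} (hσ : σ ∈ closurePermutations n) :
    ∃! v : VirtualLink, IsVirtualClosure L l σ v := by
  have hL := L.endpoints_eq_range l
  obtain ⟨c, hcσ, -, ⟨M, hM⟩, -⟩ := exists_common_partialClosure hσ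
    (Subtype.val_injective.comp l.injective) hL hL isOpen_univ Set.univ_nonempty
    (fun _ _ _ _ => trivial)
  refine ⟨_, ⟨_, hM.isClosureDiagram hσ hcσ, rfl⟩, ?_⟩
  rintro v ⟨D, hD, rfl⟩
  exact hD.toLink_eq hσ (hM.isClosureDiagram hσ hcσ)

/-! ### Triangles in linear coordinates. -/

section Triangle

/-- The linear functionals `X`, `Y`, `Z` form the basis dual to `p`, `q`, `r`. -/
structure IsDualBasis (p q r : S2) (X Y Z : E3 →ₗ[ℝ] ℝ) : Prop where
  Xp : X p = 1
  Xq : X q = 0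
  Xr : X r = 0
  Yp : Y p = 0
  Yq : Y q = 1
  Yr : Y r = 0
  Zp : Z p = 0
  Zq : Z q = 0
  Zr : Z r = 1
  expand : ∀ x : E3, x = X x • (p : E3) + Y x • (q : E3) + Z x • (r : E3)

theorem exists_isDualBasis {p q r : S2} (h : LinearIndependent ℝ ![(p : E3), (q : E3), (r : E3)]) :
    ∃ X Y Z, IsDualBasis p q r X Y Z := by
  let b := basisOfLinearIndependentOfCardEqFinrank h (by simp)
  have h0 : b 0 = p := by simp [b]
  have h1 : b 1 = q := by simp [b]
  have h2 : b 2 = r := by simp [b]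
  refine ⟨b.coord 0, b.coord 1, b.coord 2, ?_, ?_, ?_, ?_, ?_, ?_, ?_, ?_, ?_, fun x => ?_⟩
  iterate 9
    first | rw [← h0] | rw [← h1] | rw [← h2]
    simp [Module.Basis.coord_apply]
  conv_lhs => rw [← b.sum_repr x]
  rw [Fin.sum_univ_three, h0, h1, h2]
  rfl

variable {p q r : S2} {X Y Z : E3 →ₗ[ℝ] ℝ}

theorem IsDualBasis.mem_triangle (h : IsDualBasis p q r X Y Z) {x : S2} :
    x ∈ triangle p q r ↔ 0 ≤ X x ∧ 0 ≤ Y x ∧ 0 ≤ Z x := by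
  constructor
  · rintro ⟨a, b, c, ha, hb, hc, hx⟩
    rw [hx]
    simp [h.Xp, h.Xq, h.Xr, h.Yp, h.Yq, h.Yr, h.Zp, h.Zq, h.Zr, ha, hb, hc]
  · rintro ⟨ha, hb, hc⟩
    exact ⟨_, _, _, ha, hb, hc, h.expand x⟩

/-- The open cone opposite to a triangle. -/
def oppositeCone (X Y Z : E3 →ₗ[ℝ] ℝ) : Set E3 := {x | X x < 0 ∧ Y x < 0 ∧ Z x < 0}

theorem isOpen_oppositeCone (X Y Z : E3 →ₗ[ℝ] ℝ) : IsOpen (oppositeCone X Y Z) := by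
  have h : ∀ φ : E3 →ₗ[ℝ] ℝ, IsOpen {x | φ x < 0} := fun φ =>
    isOpen_lt φ.continuous_of_finiteDimensional continuous_const
  exact (h X).inter ((h Y).inter (h Z))

theorem IsDualBasis.nonempty_oppositeCone (h : IsDualBasis p q r X Y Z) :
    (oppositeCone X Y Z).Nonempty := by
  refine ⟨-((p : E3) + (q : E3) + (r : E3)), ?_, ?_, ?_⟩ <;>
  simp [h.Xp, h.Xq, h.Xr, h.Yp, h.Yq, h.Yr, h.Zp, h.Zq, h.Zr]

theorem smul_mem_oppositeCone : ∀ x ∈ oppositeCone X Y Z, ∀ a : ℝ, 0 < a →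
    a • x ∈ oppositeCone X Y Z := by
  rintro x ⟨h₁, h₂, h₃⟩ a ha
  refine ⟨?_, ?_, ?_⟩ <;> rw [map_smul, smul_eq_mul] <;> exact mul_neg_of_pos_of_neg ha (by assumption)

/-- An arc to a point of the cone opposite to a triangle stays away from the triangle. -/
theorem IsDualBasis.away (h : IsDualBasis p q r X Y Z) {P c : S2} (hc : (c : E3) ∈ oppositeCone X Y Z)
    (hP : P ∈ triangle p q r → P = p ∨ P = q) : Away p q r s(P, c) := by
  rintro x ⟨hx, hxT⟩
  obtain ⟨a, b, ha, hb, hab⟩ := mem_arc_mk.1 hx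
  rcases hb.eq_or_lt with rfl | hb
  · have : x = P := eq_of_coe_eq_smul ha (by simpa using hab)
    subst this
    simpa using hP hxT
  -- All three coordinates of `c` are negative, so a point of the triangle other than `P` on this
  -- arc forces `P` into the interior of the triangle. But `p` and `q` lie on the side `Z = 0`.
  · have aux : ∀ φ : E3 →ₗ[ℝ] ℝ, 0 ≤ φ x → φ c < 0 → 0 < φ P := by
      intro φ h0 h1
      rw [hab, map_add, map_smul, map_smul, smul_eq_mul, smul_eq_mul] at h0
      have h2 : b * φ c < 0 := mul_neg_of_pos_of_neg hb h1
      exact pos_of_mul_pos_right (by linarith) ha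
    obtain ⟨hX, hY, hZ⟩ := h.mem_triangle.1 hxT
    have hZP := aux Z hZ hc.2.2
    rcases hP (h.mem_triangle.2 ⟨(aux X hX hc.1).le, (aux Y hY hc.2.1).le, hZP.le⟩) with rfl | rfl
    · rw [h.Zp] at hZP
      exact absurd hZP (lt_irrefl _)
    · rw [h.Zq] at hZP
      exact absurd hZP (lt_irrefl _)

theorem Crosses.exists_pos {u v p q : S2} (h : Crosses s(u, v) s(p, q)) :
    ∃ α β a b : ℝ, 0 < α ∧ 0 < β ∧ 0 < a ∧ 0 < b ∧
      α • (u : E3) + β • (v : E3) = a • (p : E3) + b • (q : E3) := by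
  obtain ⟨-, x, h₁, h₂, h₃, h₄⟩ := h
  obtain ⟨α, β, hα, hβ, hx⟩ := pos_of_mem_arc h₁ h₃
  obtain ⟨a, b, ha, hb, hx'⟩ := pos_of_mem_arc h₂ h₄
  exact ⟨α, β, a, b, hα, hβ, ha, hb, hx.symm.trans hx'⟩

/-- If `u` were in the closed quadrant `X, Y ≥ 0`, eliminating `v` from the two points would show
that `β * γ - α * δ` and its negative are both positive. -/
theorem neg_of_crosses_two_lines {u v : E3} {α β γ δ : ℝ} (hβ : 0 < β) (hδ : 0 < δ)
    (h₁ : X (α • u + β • v) = 0) (h₂ : 0 < Y (α • u + β • v))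
    (h₃ : Y (γ • u + δ • v) = 0) (h₄ : 0 < X (γ • u + δ • v)) : X u < 0 ∨ Y u < 0 := by
  by_contra hn
  push Not at hn
  obtain ⟨hX, hY⟩ := hn
  simp only [map_add, map_smul, smul_eq_mul] at h₁ h₂ h₃ h₄
  have e₁ : β * (γ * X u + δ * X v) = (β * γ - α * δ) * X u := by linear_combination δ * h₁
  have e₂ : δ * (α * Y u + β * Y v) = (α * δ - β * γ) * Y u := by linear_combination β * h₃
  have p₁ := pos_of_mul_pos_left (e₁ ▸ mul_pos hβ h₄) hX
  have p₂ := pos_of_mul_pos_left (e₂ ▸ mul_pos hδ h₂) hY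
  linarith

/-- An edge that crosses two sides of a triangle has its vertices outside of the triangle. -/
theorem IsDualBasis.notMem_triangle_of_crosses (h : IsDualBasis p q r X Y Z) {e : Sym2 S2}
    (he : (Crosses e s(p, q) ∧ Crosses e s(p, r)) ∨ (Crosses e s(p, q) ∧ Crosses e s(r, q)) ∨
      (Crosses e s(p, r) ∧ Crosses e s(r, q))) {u : S2} (hu : u ∈ e) : u ∉ triangle p q r := by
  rw [h.mem_triangle]
  rintro ⟨hX, hY, hZ⟩
  obtain ⟨v, rfl⟩ := hu
  -- The sides `pq`, `pr`, `rq` lie on `Z = 0`, `Y = 0`, `X = 0`; in each case the two functionals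
  -- belonging to the crossed sides are used.
  have hs := And.intro h.Xp (And.intro h.Xq (And.intro h.Xr (And.intro h.Yp (And.intro h.Yq
    (And.intro h.Yr (And.intro h.Zp (And.intro h.Zq h.Zr)))))))
  rcases he with ⟨h₁, h₂⟩ | ⟨h₁, h₂⟩ | ⟨h₁, h₂⟩ <;>
  obtain ⟨α, β, a, b, hα, hβ, ha, hb, e₁⟩ := h₁.exists_pos <;>
  obtain ⟨γ, δ, a', b', hγ, hδ, ha', hb', e₂⟩ := h₂.exists_pos
  · rcases neg_of_crosses_two_lines (X := Z) (Y := Y) hβ hδ (by rw [e₁]; simp [hs])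
      (by rw [e₁]; simp [hs, hb]) (by rw [e₂]; simp [hs]) (by rw [e₂]; simp [hs, hb'])
      with hn | hn <;> linarith
  · rcases neg_of_crosses_two_lines (X := Z) (Y := X) hβ hδ (by rw [e₁]; simp [hs])
      (by rw [e₁]; simp [hs, ha]) (by rw [e₂]; simp [hs]) (by rw [e₂]; simp [hs, ha'])
      with hn | hn <;> linarith
  · rcases neg_of_crosses_two_lines (X := Y) (Y := X) hβ hδ (by rw [e₁]; simp [hs])
      (by rw [e₁]; simp [hs, ha]) (by rw [e₂]; simp [hs]) (by rw [e₂]; simp [hs, hb'])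
      with hn | hn <;> linarith

/-- An edge that begins in a vertex of a triangle and crosses the opposite side ends outside of the
triangle. -/
theorem IsDualBasis.notMem_triangle_of_crosses_opposite (h : IsDualBasis p q r X Y Z) {s : S2}
    (hs : Crosses s(q, s) s(p, r)) : s ∉ triangle p q r := by
  rw [h.mem_triangle]
  rintro ⟨-, hY, -⟩
  obtain ⟨α, β, a, b, hα, hβ, -, -, e⟩ := hs.exists_pos
  have := congrArg Y e
  simp only [map_add, map_smul, smul_eq_mul, h.Yp, h.Yq, h.Yr, mul_one, mul_zero, add_zero] at this
  nlinarith

end Triangle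

/-! ### Replacing an edge across a triangle, in the presence of extra virtual edges. -/

section Replaces

variable {D D' : Diagram} {p q r : S2}

namespace Diagram

theorem Replaces.ne (h : Replaces D D' p q r) : p ≠ q ∧ p ≠ r ∧ q ≠ r := by
  have hi := h.1.injective
  refine ⟨?_, ?_, ?_⟩ <;> rintro rfl
  · exact absurd (@hi 0 1 rfl) (by simp)
  · exact absurd (@hi 0 2 rfl) (by simp)
  · exact absurd (@hi 1 2 rfl) (by simp)

theorem Replaces.mem_edges_iff (h : Replaces D D' p q r) {e : Sym2 S2} :
    e ∈ D'.edges ↔ (e ∈ D.edges ∧ e ≠ s(p, q)) ∨ e = s(p, r) ∨ e = s(r, q) := by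
  rw [h.2.2.2.2.1]; rfl

/-- The new vertex lies on no edge of the old diagram. -/
theorem Replaces.notMem_vertices (h : Replaces D D' p q r) : r ∉ D.vertices := by
  obtain ⟨hpq, hpr, hqr⟩ := h.ne
  rintro ⟨e, he, hre⟩
  have hepq : e ≠ s(p, q) := by
    rintro rfl
    simp [hpr.symm, hqr.symm] at hre
  have h₁ : e ≠ s(p, r) := by rintro rfl; exact h.2.2.1 he
  have h₂ : e ≠ s(r, q) := by rintro rfl; exact h.2.2.2.1 he
  have h₃ : s(p, r) ≠ s(r, q) := by simp [hpr, hpq]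
  -- Such an edge would survive in `D'` and meet both new edges in `r`.
  exact Set.eq_empty_iff_forall_notMem.1 (D'.no_triple e (h.mem_edges_iff.2 (Or.inl ⟨he, hepq⟩))
    s(p, r) (h.mem_edges_iff.2 (by simp)) s(r, q) (h.mem_edges_iff.2 (by simp)) h₁ h₃ h₂) r
    ⟨⟨mem_arc_of_mem hre, mem_arc_of_mem (by simp)⟩, mem_arc_of_mem (by simp)⟩

/-- At `p` and at `q` one edge is exchanged for one other, and `r` lies on both new edges.
Labellings can therefore be carried over. -/
theorem Replaces.endpoints_eq (h : Replaces D D' p q r) : D'.endpoints = D.endpoints := by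
  obtain ⟨hpq, hpr, hqr⟩ := h.ne
  have hpqD : s(p, q) ∈ D.edges := h.2.1
  have hprD : s(p, r) ∉ D.edges := h.2.2.1
  have hrqD : s(r, q) ∉ D.edges := h.2.2.2.1
  have hprD' : s(p, r) ∈ D'.edges := h.mem_edges_iff.2 (by simp)
  have hrqD' : s(r, q) ∈ D'.edges := h.mem_edges_iff.2 (by simp)
  ext x
  constructor
  · rintro ⟨e, ⟨he, hxe⟩, huniq⟩
    have hxr : x ≠ r := by
      rintro rfl
      have h₁ := huniq s(p, x) ⟨hprD', by simp⟩
      have h₂ := huniq s(x, q) ⟨hrqD', by simp⟩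
      have h₃ := h₁.trans h₂.symm
      simp [hpr, hpq] at h₃
    rcases h.mem_edges_iff.1 he with ⟨heD, hepq⟩ | rfl | rfl
    · have hxp : x ≠ p := by
        rintro rfl
        exact hprD (huniq _ ⟨hprD', by simp⟩ ▸ heD)
      have hxq : x ≠ q := by
        rintro rfl
        exact hrqD (huniq _ ⟨hrqD', by simp⟩ ▸ heD)
      refine ⟨e, ⟨heD, hxe⟩, fun f hf => huniq f ⟨h.mem_edges_iff.2 (Or.inl ⟨hf.1, ?_⟩), hf.2⟩⟩
      rintro rfl
      simp [hxp, hxq] at hf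
    · have hxp : x = p := by simpa [hxr] using hxe
      subst hxp
      refine ⟨s(x, q), ⟨hpqD, by simp⟩, fun f hf => ?_⟩
      by_contra hfn
      exact hprD (huniq f ⟨h.mem_edges_iff.2 (Or.inl ⟨hf.1, hfn⟩), hf.2⟩ ▸ hf.1)
    · have hxq : x = q := by simpa [hxr] using hxe
      subst hxq
      refine ⟨s(p, x), ⟨hpqD, by simp⟩, fun f hf => ?_⟩
      by_contra hfn
      exact hrqD (huniq f ⟨h.mem_edges_iff.2 (Or.inl ⟨hf.1, hfn⟩), hf.2⟩ ▸ hf.1)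
  · intro hx
    have hxr : x ≠ r := by
      rintro rfl
      exact h.notMem_vertices (D.endpoints_subset_vertices hx)
    obtain ⟨e, ⟨he, hxe⟩, huniq⟩ := hx
    by_cases hepq : e = s(p, q)
    · subst hepq
      rcases Sym2.mem_iff.1 hxe with rfl | rfl
      · refine ⟨s(x, r), ⟨hprD', by simp⟩, ?_⟩
        rintro f ⟨hf, hxf⟩
        rcases h.mem_edges_iff.1 hf with ⟨hfD, hfpq⟩ | rfl | rfl
        · exact absurd (huniq f ⟨hfD, hxf⟩) hfpq
        · rfl
        · simp [hxr, hpq] at hxf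
      · refine ⟨s(r, x), ⟨hrqD', by simp⟩, ?_⟩
        rintro f ⟨hf, hxf⟩
        rcases h.mem_edges_iff.1 hf with ⟨hfD, hfpq⟩ | rfl | rfl
        · exact absurd (huniq f ⟨hfD, hxf⟩) hfpq
        · simp [hxr, hpq.symm] at hxf
        · rfl
    · have hxp : x ≠ p := by
        rintro rfl
        exact hepq (huniq _ ⟨hpqD, by simp⟩).symm
      have hxq : x ≠ q := by
        rintro rfl
        exact hepq (huniq _ ⟨hpqD, by simp⟩).symm
      refine ⟨e, ⟨h.mem_edges_iff.2 (Or.inl ⟨he, hepq⟩), hxe⟩, ?_⟩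
      rintro f ⟨hf, hxf⟩
      rcases h.mem_edges_iff.1 hf with ⟨hfD, hfpq⟩ | rfl | rfl
      · exact huniq f ⟨hfD, hxf⟩
      · simp [hxr, hxp] at hxf
      · simp [hxr, hxq] at hxf

end Diagram

/-- The diagrams `D` and `D'` arise from `K` and `K'` by adding the same virtual edges, which stay away
from the triangle `pqr` in which `K` and `K'` differ. -/
structure IsCommonExtension (p q r : S2) (K K' D D' : Diagram) : Prop where
  replaces : Replaces D D' p q r
  subset : K.edges ⊆ D.edges
  away : ∀ e ∈ D.edges, e ∉ K.edges → Away p q r e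
  notMem : ∀ e ∈ D.edges, e ∉ K.edges → e ∉ K'.edges
  isOver_eq : D.isOver = K.isOver
  isOver_eq' : D'.isOver = K'.isOver

namespace IsCommonExtension

variable {K K' : Diagram}

/-- An added edge is over or under nothing, before and after, so for it both equivalences hold
between false statements. -/
theorem sameType (h : IsCommonExtension p q r K K' D D')
    (hst : ∀ e ∈ K.edges \ {s(p, q)}, SameType K K' p q r e) :
    ∀ e ∈ D.edges \ {s(p, q)}, SameType D D' p q r e := by
  intro e he g hg hcr
  rw [h.isOver_eq, h.isOver_eq']
  by_cases heK : e ∈ K.edges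
  · exact hst e ⟨heK, he.2⟩ g hg hcr
  · have heK' := h.notMem e he.1 heK
    exact ⟨iff_of_false (fun h => heK' (K'.crosses_of_isOver _ _ h).1)
        (fun h => heK (K.crosses_of_isOver _ _ h).1),
      iff_of_false (fun h => heK' (K'.crosses_of_isOver _ _ h).2.1)
        (fun h => heK (K.crosses_of_isOver _ _ h).2.1)⟩

theorem isotopy (h : IsCommonExtension p q r K K' D D')
    (h₁ : ∀ e ∈ K.edges \ {s(p, q)}, Away p q r e ∨ Traverses p q r e)
    (h₂ : ∀ e ∈ K.edges \ {s(p, q)}, ∀ f ∈ K.edges \ {s(p, q)}, e ≠ f →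
      arc e ∩ arc f ∩ triangle p q r = ∅)
    (h₃ : ∀ e ∈ K.edges \ {s(p, q)}, SameType K K' p q r e) : Isotopy D D' := by
  -- An added edge meets the triangle only in `p` or `q`; a further edge through that point would
  -- form a triple point with it and `pq`.
  have aux : ∀ e ∈ D.edges \ {s(p, q)}, e ∉ K.edges → ∀ f ∈ D.edges \ {s(p, q)}, e ≠ f →
      ∀ x, x ∈ arc e → x ∈ arc f → x ∉ triangle p q r := by
    intro e he heK f hf hef x hxe hxf hxT
    have hx : x ∈ arc s(p, q) := by
      rcases h.away e he.1 heK ⟨hxe, hxT⟩ with rfl | rfl <;> exact mem_arc_of_mem (by simp)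
    exact Set.eq_empty_iff_forall_notMem.1 (D.no_triple e he.1 f hf.1 s(p, q) h.replaces.2.1 hef
      hf.2 he.2) x ⟨⟨hxe, hxf⟩, hx⟩
  refine ⟨p, q, r, h.replaces, fun e he => ?_, fun e he f hf hef => ?_, h.sameType h₃⟩
  · by_cases heK : e ∈ K.edges
    · exact h₁ e ⟨heK, he.2⟩
    · exact Or.inl (h.away e he.1 heK)
  · by_cases heK : e ∈ K.edges
    · by_cases hfK : f ∈ K.edges
      · exact h₂ e ⟨heK, he.2⟩ f ⟨hfK, hf.2⟩ hef
      · exact Set.eq_empty_iff_forall_notMem.2 fun x hx =>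
          aux f hf hfK e he hef.symm x hx.1.2 hx.1.1 hx.2
    · exact Set.eq_empty_iff_forall_notMem.2 fun x hx =>
        aux e he heK f hf hef x hx.1.1 hx.1.2 hx.2

theorem away_of_away (h : IsCommonExtension p q r K K' D D') {P : Sym2 S2 → Prop}
    (hK : ∀ e ∈ K.edges \ {s(p, q)}, P e → Away p q r e) :
    ∀ e ∈ D.edges \ {s(p, q)}, P e → Away p q r e := by
  intro e he hP
  by_cases heK : e ∈ K.edges
  · exact hK e ⟨heK, he.2⟩ hP
  · exact h.away e he.1 heK

end IsCommonExtension

end Replaces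

/-! ### Independence of the labelling, and invariance under isotopy and the Reidemeister moves. -/

section Spectrum

variable {n : ℕ}

theorem LinkoidDiagram.nonempty_labelling (L : LinkoidDiagram n) : Nonempty L.Labelling := by
  have : Finite L.endpoints := L.finite_vertices.subset L.endpoints_subset_vertices
  exact ⟨(Finite.equivFinOfCardEq L.card_endpoints).symm⟩

/-- By uniqueness, one well-chosen pair of closure diagrams for each `σ` decides. -/
theorem spec_eq_of_common_closures {L L' : LinkoidDiagram n} {l : L.Labelling} {l' : L'.Labelling}
    (h : ∀ σ ∈ closurePermutations n, ∃ D D' : VirtualLinkDiagram, IsClosureDiagram L l σ D ∧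
      IsClosureDiagram L' l' σ D' ∧ D.toLink = D'.toLink) : spec L l = spec L' l' := by
  ext v
  constructor
  · rintro ⟨σ, hσ, E, hE, rfl⟩
    obtain ⟨D, D', hD, hD', hDD'⟩ := h σ hσ
    exact ⟨σ, hσ, D', hD', by rw [← hDD', hE.toLink_eq hσ hD]⟩
  · rintro ⟨σ, hσ, E, hE, rfl⟩
    obtain ⟨D, D', hD, hD', hDD'⟩ := h σ hσ
    exact ⟨σ, hσ, D, hD, by rw [hDD', hE.toLink_eq hσ hD']⟩

/-- The virtual spectrum does not depend on the labelling. -/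
theorem spec_eq_spec (L : LinkoidDiagram n) (l l' : L.Labelling) : spec L l = spec L l' := by
  have key : ∀ l l' : L.Labelling, spec L l ⊆ spec L l' := by
    rintro l l' v ⟨σ, hσ, D, hD, rfl⟩
    obtain ⟨A, h⟩ := isClosureDiagram_iff.1 hD
    let τ : Equiv.Perm (Fin (2 * n)) := l'.trans l.symm
    have hl : ∀ i, l (τ i) = l' i := fun i => by simp [τ]
    have hτ : ∀ i, τ (τ.symm (σ (τ i))) = σ (τ i) := fun i => by simp
    -- The same diagram serves, with `σ` conjugated by the change of labels `τ` and the arcs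
    -- renumbered accordingly.
    refine ⟨(τ.trans σ).trans τ.symm, fun i => ⟨?_, fun hi => ?_⟩, D, ?_, rfl⟩
    · simp [(hσ _).1]
    · exact (hσ (τ i)).2 (τ.symm_apply_eq.1 hi)
    · refine isClosureDiagram_iff.2 ⟨fun i => A (τ i), fun i => ?_, fun i => ?_, fun i j hij hij' => ?_,
        fun i => h.disjoint_edges _, ?_, h.isOver_iff⟩
      · rw [← hl, ← hl]
        simpa using h.path (τ i)
      · simpa using h.symm (τ i)
      · exact h.disjoint _ _ (τ.injective.ne hij) fun hj => hij' (τ.eq_symm_apply.2 hj)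
      · rw [h.edges_eq, τ.surjective.iUnion_comp A]
  exact (key l l').antisymm (key l' l)

/-- Diagrams that differ in a triangle which contains no endpoints can be closed by the same virtual
arcs. -/
theorem exists_isCommonExtension {L L' : LinkoidDiagram n} {p q r : S2}
    (h : Replaces L.toDiagram L'.toDiagram p q r)
    (hT : ∀ x ∈ L.endpoints, x ∈ triangle p q r → x = p ∨ x = q) {l : L.Labelling}
    {l' : L'.Labelling} (hl : ∀ i, (l' i : S2) = l i) {σ : Equiv.Perm (Fin (2 * n))}
    (hσ : σ ∈ closurePermutations n) :
    ∃ D D' : VirtualLinkDiagram, IsClosureDiagram L l σ D ∧ IsClosureDiagram L' l' σ D' ∧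
      IsCommonExtension p q r L.toDiagram L'.toDiagram D.toDiagram D'.toDiagram := by
  obtain ⟨X, Y, Z, hd⟩ := exists_isDualBasis h.1
  have hL := L.endpoints_eq_range l
  have hL' := L'.endpoints_eq_range l'
  have hll : (fun i => (l' i : S2)) = fun i => (l i : S2) := funext hl
  obtain ⟨c, hcσ, hcU, ⟨M, hM⟩, ⟨M', hM'⟩⟩ := exists_common_partialClosure hσ
    (Subtype.val_injective.comp l.injective) hL (hL'.trans (congrArg Set.range hll))
    (isOpen_oppositeCone X Y Z) hd.nonempty_oppositeCone smul_mem_oppositeCone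
  have hM'' : IsPartialClosure L'.toDiagram (fun i => (l' i : S2)) c Set.univ M' := by
    rw [hll]; exact hM'
  refine ⟨_, _, hM.isClosureDiagram hσ hcσ, hM''.isClosureDiagram hσ hcσ, ?_⟩
  change IsCommonExtension p q r L.toDiagram L'.toDiagram M M'
  have hMe : ∀ e, e ∈ M.edges ↔ e ∈ L.edges ∨ ∃ i, s((l i : S2), c i) = e := fun e => by
    rw [hM.edges_eq]; simp
  have hM'e : ∀ e, e ∈ M'.edges ↔ e ∈ L'.edges ∨ ∃ i, s((l i : S2), c i) = e := fun e => by
    rw [hM'.edges_eq]; simp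
  have hnm : ∀ e ∈ M.edges, e ∉ L.edges → e ∉ L'.edges := by
    intro e he heL
    obtain ⟨i, rfl⟩ := ((hMe e).1 he).resolve_left heL
    exact hM'.notMem i trivial
  refine ⟨⟨h.1, (hMe _).2 (Or.inl h.2.1), ?_, ?_, ?_, ?_⟩, fun e he => (hMe e).2 (Or.inl he), ?_, hnm,
    hM.isOver_eq, hM'.isOver_eq⟩
  · intro he
    exact hnm _ he h.2.2.1 (h.mem_edges_iff.2 (by simp))
  · intro he
    exact hnm _ he h.2.2.2.1 (h.mem_edges_iff.2 (by simp))
  · ext e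
    have hsp : (∃ i, s((l i : S2), c i) = e) → e ≠ s(p, q) := by
      rintro ⟨i, rfl⟩ heq
      exact hM.notMem i trivial (heq ▸ h.2.1)
    simp only [hM'e, h.mem_edges_iff, hMe, Set.mem_union, Set.mem_sdiff, Set.mem_singleton_iff,
      Set.mem_insert_iff]
    tauto
  · intro e he f hf
    rw [hM.isOver_eq, hM'.isOver_eq]
    by_cases heL : e ∈ L.edges
    · by_cases hfL : f ∈ L.edges
      · exact h.2.2.2.2.2 e ⟨heL, he.2⟩ f ⟨hfL, hf.2⟩
      · exact iff_of_false (fun ho => hnm f hf.1 hfL (L'.crosses_of_isOver _ _ ho).2.1)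
          (fun ho => hfL (L.crosses_of_isOver _ _ ho).2.1)
    · exact iff_of_false (fun ho => hnm e he.1 heL (L'.crosses_of_isOver _ _ ho).1)
        (fun ho => heL (L.crosses_of_isOver _ _ ho).1)
  · intro e he heL
    obtain ⟨i, rfl⟩ := ((hMe e).1 he).resolve_left heL
    exact hd.away (hcU i) (hT _ (l i).2)

/-- The common frame for isotopy and the three Reidemeister moves. The hypothesis `hT` keeps
endpoints other than `p`, `q` out of the triangle; each edge that a move lets into the triangle
satisfies it by crossing sides. -/
theorem spec_eq_of_replaces {L L' : LinkoidDiagram n} {p q r : S2}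
    (h : Replaces L.toDiagram L'.toDiagram p q r)
    (hT : ∀ e ∈ L.edges \ {s(p, q)}, Away p q r e ∨ ∀ x ∈ e, x ∈ triangle p q r → x = p ∨ x = q)
    (hmove : ∀ D D' : VirtualLinkDiagram,
      IsCommonExtension p q r L.toDiagram L'.toDiagram D.toDiagram D'.toDiagram → VirtualMove D D')
    (l : L.Labelling) (l' : L'.Labelling) : spec L l = spec L' l' := by
  let l'' : L'.Labelling := l.trans (Equiv.setCongr h.endpoints_eq.symm)
  rw [spec_eq_spec L' l' l'']
  refine spec_eq_of_common_closures fun σ hσ => ?_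
  have hT' : ∀ x ∈ L.endpoints, x ∈ triangle p q r → x = p ∨ x = q := by
    rintro x ⟨e, ⟨he, hxe⟩, -⟩ hxT
    by_cases hepq : e = s(p, q)
    · subst hepq
      simpa using hxe
    · rcases hT e ⟨he, hepq⟩ with ha | ha
      · simpa using ha ⟨mem_arc_of_mem hxe, hxT⟩
      · exact ha x hxe hxT
  obtain ⟨D, D', hD, hD', hDD'⟩ := exists_isCommonExtension h hT' (l := l) (l' := l'')
    (fun _ => rfl) hσ
  exact ⟨D, D', hD, hD', (hmove D D' hDD').toLink_eq⟩

theorem spec_eq_of_isotopy {L L' : LinkoidDiagram n} (h : Isotopy L.toDiagram L'.toDiagram)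
    (l : L.Labelling) (l' : L'.Labelling) : spec L l = spec L' l' := by
  obtain ⟨p, q, r, hrep, h₁, h₂, h₃⟩ := h
  obtain ⟨X, Y, Z, hd⟩ := exists_isDualBasis hrep.1
  refine spec_eq_of_replaces hrep (fun e he => (h₁ e he).imp_right fun ht x hx hxT => ?_)
    (fun D D' hDD' => Or.inl (hDD'.isotopy h₁ h₂ h₃)) l l'
  refine absurd hxT (hd.notMem_triangle_of_crosses ?_ hx)
  rcases ht with ⟨ht, ht' | ht'⟩
  · exact Or.inl ⟨ht, ht'⟩
  · exact Or.inr (Or.inl ⟨ht, ht'⟩)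

theorem spec_eq_of_reidemeisterI {L L' : LinkoidDiagram n}
    (h : ReidemeisterI L.toDiagram L'.toDiagram) (l : L.Labelling) (l' : L'.Labelling) :
    spec L l = spec L' l' := by
  obtain ⟨p, q, r, s, hrep, h₁, h₂, h₃, h₄⟩ := h
  obtain ⟨X, Y, Z, hd⟩ := exists_isDualBasis hrep.1
  refine spec_eq_of_replaces hrep (fun e he => ?_) (fun D D' hDD' => Or.inr (Or.inl ?_)) l l'
  · by_cases hes : e = s(q, s)
    · subst hes
      refine Or.inr fun x hx hxT => ?_
      rcases Sym2.mem_iff.1 hx with rfl | rfl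
      · exact Or.inr rfl
      · exact absurd hxT (hd.notMem_triangle_of_crosses_opposite h₂)
    · exact Or.inl (h₄ e he hes)
  · refine ⟨p, q, r, s, hDD'.replaces, ⟨hDD'.subset h₁.1, h₁.2⟩, h₂, ?_, hDD'.away_of_away h₄⟩
    unfold Diagram.Classical
    rw [hDD'.isOver_eq']
    exact h₃

theorem spec_eq_of_reidemeisterII {L L' : LinkoidDiagram n}
    (h : ReidemeisterII L.toDiagram L'.toDiagram) (l : L.Labelling) (l' : L'.Labelling) :
    spec L l = spec L' l' := by
  obtain ⟨p, q, r, e, hrep, h₁, h₂, h₃, h₄, h₅⟩ := h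
  obtain ⟨X, Y, Z, hd⟩ := exists_isDualBasis hrep.1
  refine spec_eq_of_replaces hrep (fun f hf => ?_) (fun D D' hDD' => Or.inr (Or.inr (Or.inl ?_))) l l'
  · by_cases hfe : f = e
    · subst hfe
      exact Or.inr fun x hx hxT =>
        absurd hxT (hd.notMem_triangle_of_crosses (Or.inr (Or.inr ⟨h₂, h₃⟩)) hx)
    · exact Or.inl (h₅ f hf hfe)
  · refine ⟨p, q, r, e, hDD'.replaces, ⟨hDD'.subset h₁.1, h₁.2⟩, h₂, h₃, ?_, hDD'.away_of_away h₅⟩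
    rw [hDD'.isOver_eq']
    exact h₄

theorem spec_eq_of_reidemeisterIII {L L' : LinkoidDiagram n}
    (h : ReidemeisterIII L.toDiagram L'.toDiagram) (l : L.Labelling) (l' : L'.Labelling) :
    spec L l = spec L' l' := by
  obtain ⟨p, q, r, e, f, hrep, he, hf, hef, hte, htf, hne, hover, hse, hsf, haway⟩ := h
  obtain ⟨X, Y, Z, hd⟩ := exists_isDualBasis hrep.1
  have aux : ∀ g, Traverses p q r g → ∀ x ∈ g, x ∈ triangle p q r → x = p ∨ x = q := by
    intro g ht x hx hxT
    refine absurd hxT (hd.notMem_triangle_of_crosses ?_ hx)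
    rcases ht with ⟨ht, ht' | ht'⟩
    · exact Or.inl ⟨ht, ht'⟩
    · exact Or.inr (Or.inl ⟨ht, ht'⟩)
  refine spec_eq_of_replaces hrep (fun g hg => ?_)
    (fun D D' hDD' => Or.inr (Or.inr (Or.inr (Or.inl ?_)))) l l'
  · by_cases hge : g = e
    · exact Or.inr (hge ▸ aux e hte)
    by_cases hgf : g = f
    · exact Or.inr (hgf ▸ aux f htf)
    exact Or.inl (haway g hg hge hgf)
  · have hst : ∀ g, SameType L.toDiagram L'.toDiagram p q r g →
        SameType D.toDiagram D'.toDiagram p q r g := by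
      intro g hg
      unfold SameType
      rw [hDD'.isOver_eq, hDD'.isOver_eq']
      exact hg
    refine ⟨p, q, r, e, f, hDD'.replaces, ⟨hDD'.subset he.1, he.2⟩, ⟨hDD'.subset hf.1, hf.2⟩, hef,
      hte, htf, hne, ?_, hst e hse, hst f hsf, fun g hg hge hgf => ?_⟩
    · unfold Diagram.Classical
      rw [hDD'.isOver_eq]
      exact hover
    · exact hDD'.away_of_away (P := fun g => g ≠ e ∧ g ≠ f) (fun g hg hP => haway g hg hP.1 hP.2)
        g hg ⟨hge, hgf⟩

end Spectrum

/-! ### Invariance under isotopy near an endpoint. -/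

/-- Prolonging a path by an edge at its beginning. -/
theorem Diagram.IsPathBetween.cons {A : Set (Sym2 S2)} {p p' q : S2} (h : IsPathBetween A p' q)
    (hp : p ≠ p') (hA : ∀ e ∈ A, p ∉ e) : IsPathBetween (insert s(p, p') A) p q := by
  obtain ⟨w, hw, hwA⟩ := h
  have hle : SimpleGraph.fromEdgeSet A ≤ SimpleGraph.fromEdgeSet (insert s(p, p') A) :=
    SimpleGraph.fromEdgeSet_mono (Set.subset_insert _ _)
  have hadj : (SimpleGraph.fromEdgeSet (insert s(p, p') A)).Adj p p' := by simp [hp]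
  have hsupp : p ∉ w.support := by
    clear hw hwA hle hadj
    induction w with
    | nil => simpa using hp
    | @cons u v z huv w ih =>
      have hv : p ≠ v := by
        rintro rfl
        exact hA _ ((SimpleGraph.fromEdgeSet_adj _).1 huv).1 (by simp)
      simp only [SimpleGraph.Walk.support_cons, List.mem_cons, not_or]
      exact ⟨hp, ih hv⟩
  refine ⟨.cons hadj (w.mapLe hle), ?_, ?_⟩
  · rw [SimpleGraph.Walk.cons_isPath_iff]
    exact ⟨hw.mapLe hle, by simpa using hsupp⟩
  · ext e
    have he : e ∈ w.edges ↔ e ∈ A := Set.ext_iff.1 hwA e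
    simp [he]

variable {n : ℕ}

/-- The diagram `D` is unchanged: the edge from `p` to `p'` is reassigned from the linkoid to the
closure arc at the label `k`. -/
theorem IsClosureFamily.of_endpointIsotopy {L L' : LinkoidDiagram n} {l : L.Labelling}
    {l' : L'.Labelling} {σ : Equiv.Perm (Fin (2 * n))} (hσ : σ ∈ closurePermutations n)
    {A : Fin (2 * n) → Set (Sym2 S2)} {D : VirtualLinkDiagram} (h : IsClosureFamily L' l' σ A D)
    {p p' : S2} (hp : p ∈ L.endpoints) (hpp' : s(p, p') ∉ L.edges)
    (hedges : L'.edges = insert s(p, p') L.edges)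
    (hover : ∀ e f, L'.isOver e f ↔ L.isOver e f) {k : Fin (2 * n)} (hk' : (l' k : S2) = p')
    (hk : (l k : S2) = p) (hl : ∀ i, i ≠ k → (l i : S2) = l' i) :
    IsClosureFamily L l σ
      (fun i => if i = k ∨ i = σ k then insert s(p, p') (A i) else A i) D := by
  have hLL' : L.edges ⊆ L'.edges := by rw [hedges]; exact Set.subset_insert _ _
  have hppL' : s(p, p') ∈ L'.edges := by rw [hedges]; exact Set.mem_insert _ _
  have hppA : ∀ i, s(p, p') ∉ A i := fun i => Set.disjoint_left.1 (h.disjoint_edges i) hppL'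
  have hsw := map_eq_or_iff hσ k
  -- The prolonged arc stays a simple path: through `p` already pass the last edge of `L` and the
  -- edge to `p'`, so an edge of `A k` there would make a triple point.
  have hpA : ∀ e ∈ A k, p ∉ e := by
    intro e he hpe
    obtain ⟨e₀, ⟨he₀, hpe₀⟩, -⟩ := hp
    have h₁ : e₀ ≠ s(p, p') := by rintro rfl; exact hpp' he₀
    have h₂ : s(p, p') ≠ e := by rintro rfl; exact hppA k he
    have h₃ : e₀ ≠ e := by
      rintro rfl; exact Set.disjoint_left.1 (h.disjoint_edges k) (hLL' he₀) he
    exact Set.eq_empty_iff_forall_notMem.1 (D.no_triple e₀ (h.edges_subset (hLL' he₀)) s(p, p')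
      (h.edges_subset hppL') e (h.arc_subset k he) h₁ h₂ h₃) p
      ⟨⟨mem_arc_of_mem hpe₀, mem_arc_of_mem (by simp)⟩, mem_arc_of_mem hpe⟩
  have hpath : IsPathBetween (insert s(p, p') (A k)) (l k) (l (σ k)) := by
    rw [hk, hl _ (hσ k).2]
    exact IsPathBetween.cons (hk' ▸ h.path k) (L'.nondegenerate p p' hppL').1 hpA
  refine ⟨fun i => ?_, fun i => ?_, fun i j hij hij' => ?_, fun i => ?_, ?_, fun e f => ?_⟩
  · by_cases hi : i = k ∨ i = σ k
    · simp only [if_pos hi]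
      rcases hi with rfl | rfl
      · exact hpath
      · rw [h.symm k, (hσ k).1]
        exact hpath.symm
    · simp only [if_neg hi]
      rw [hl i fun hi' => hi (Or.inl hi'), hl (σ i) fun hi' => hi ((hsw i).1 (Or.inl hi'))]
      exact h.path i
  · simp only [hsw, h.symm]
  · have hd := h.disjoint i j hij hij'
    by_cases hi : i = k ∨ i = σ k
    · have hj : ¬(j = k ∨ j = σ k) := by
        rintro (rfl | rfl)
        · rcases hi with rfl | rfl
          · exact hij rfl
          · exact hij' (hσ _).1.symm
        · rcases hi with rfl | rfl
          · exact hij' rfl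
          · exact hij rfl
      simp only [if_pos hi, if_neg hj]
      exact Set.disjoint_insert_left.2 ⟨hppA j, hd⟩
    · by_cases hj : j = k ∨ j = σ k
      · simp only [if_pos hj, if_neg hi]
        exact Set.disjoint_insert_right.2 ⟨hppA i, hd⟩
      · simpa only [if_neg hi, if_neg hj] using hd
  · have hd := (h.disjoint_edges i).mono_left hLL'
    by_cases hi : i = k ∨ i = σ k
    · simp only [if_pos hi]
      exact Set.disjoint_insert_right.2 ⟨hpp', hd⟩
    · simpa only [if_neg hi] using hd
  · rw [h.edges_eq, hedges]
    ext e
    simp only [Set.mem_union, Set.mem_insert_iff, Set.mem_iUnion]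
    constructor
    · rintro ((rfl | he) | ⟨i, hi⟩)
      · exact Or.inr ⟨k, by simp⟩
      · exact Or.inl he
      · refine Or.inr ⟨i, ?_⟩
        split_ifs
        · exact Or.inr hi
        · exact hi
    · rintro (he | ⟨i, hi⟩)
      · exact Or.inl (Or.inr he)
      · split_ifs at hi
        · rcases hi with rfl | hi
          · exact Or.inl (Or.inl rfl)
          · exact Or.inr ⟨i, hi⟩
        · exact Or.inr ⟨i, hi⟩
  · rw [h.isOver_iff, hover]

theorem endpoints_of_prolongation {K K' : Diagram} {p p' : S2} (hp : p ∈ K.endpoints)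
    (hpp' : s(p, p') ∉ K.edges) (hedges : K'.edges = insert s(p, p') K.edges)
    (hmeet : ∀ e ∈ K.edges, arc e ∩ arc s(p, p') ⊆ {p}) :
    K'.endpoints = insert p' (K.endpoints \ {p}) := by
  have hmem : ∀ e, e ∈ K'.edges ↔ e = s(p, p') ∨ e ∈ K.edges := fun e => by rw [hedges]; rfl
  have hne : p ≠ p' := (K'.nondegenerate p p' ((hmem _).2 (Or.inl rfl))).1
  have hp' : ∀ e ∈ K.edges, p' ∉ e := fun e he h =>
    hne (hmeet e he ⟨mem_arc_of_mem h, mem_arc_of_mem (by simp)⟩).symm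
  ext x
  constructor
  · rintro ⟨e, ⟨he, hxe⟩, huniq⟩
    by_cases hxp' : x = p'
    · exact Or.inl hxp'
    have hxp : x ≠ p := by
      rintro rfl
      obtain ⟨e₀, ⟨he₀, hxe₀⟩, -⟩ := hp
      have h₁ := huniq e₀ ⟨(hmem _).2 (Or.inr he₀), hxe₀⟩
      have h₂ := huniq s(x, p') ⟨(hmem _).2 (Or.inl rfl), by simp⟩
      exact hpp' (h₂ ▸ h₁ ▸ he₀)
    rcases (hmem e).1 he with rfl | he
    · simp [hxp, hxp'] at hxe
    · exact Or.inr ⟨⟨e, ⟨he, hxe⟩, fun f hf => huniq f ⟨(hmem _).2 (Or.inr hf.1), hf.2⟩⟩, hxp⟩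
  · rintro (rfl | ⟨⟨e, ⟨he, hxe⟩, huniq⟩, hxp⟩)
    · refine ⟨s(p, x), ⟨(hmem _).2 (Or.inl rfl), by simp⟩, ?_⟩
      rintro f ⟨hf, hxf⟩
      exact ((hmem f).1 hf).resolve_right fun hf => hp' f hf hxf
    · have hxp' : x ≠ p' := by
        rintro rfl
        exact hp' e he hxe
      refine ⟨e, ⟨(hmem _).2 (Or.inr he), hxe⟩, ?_⟩
      rintro f ⟨hf, hxf⟩
      rcases (hmem f).1 hf with rfl | hf
      · rcases Sym2.mem_iff.1 hxf with h | h
        · exact absurd h hxp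
        · exact absurd h hxp'
      · exact huniq f ⟨hf, hxf⟩

theorem spec_eq_of_endpointIsotopy {L L' : LinkoidDiagram n}
    (h : EndpointIsotopy L.toDiagram L'.toDiagram) (l : L.Labelling) (l' : L'.Labelling) :
    spec L l = spec L' l' := by
  classical
  obtain ⟨p, p', hp, hpp', hedges, hmeet, hover⟩ := h
  have hend := endpoints_of_prolongation hp hpp' hedges hmeet
  have hp' : p' ∉ L.endpoints := by
    intro hp'
    obtain ⟨e, he, hpe⟩ := L.endpoints_subset_vertices hp'
    have hx := hmeet e he ⟨mem_arc_of_mem hpe, mem_arc_of_mem (by simp)⟩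
    refine (L'.nondegenerate p p' ?_).1 hx.symm
    rw [hedges]
    exact Set.mem_insert _ _
  let k := l'.symm ⟨p', by rw [hend]; exact Set.mem_insert _ _⟩
  have hk : (l' k : S2) = p' := by simp [k]
  have hne : ∀ i, i ≠ k → (l' i : S2) ∈ L.endpoints ∧ (l' i : S2) ≠ p := by
    intro i hi
    have hi' : (l' i : S2) ∈ insert p' (L.endpoints \ {p}) := hend ▸ (l' i).2
    exact hi'.resolve_left fun heq => hi (l'.injective (Subtype.ext (heq.trans hk.symm)))
  -- The labelling of `L` that agrees with `l'` except that the label of `p'` is moved to `p`.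
  let g : Fin (2 * n) → L.endpoints := fun i =>
    if hi : i = k then ⟨p, hp⟩ else ⟨l' i, (hne i hi).1⟩
  have hgk : (g k : S2) = p := by simp [g]
  have hg : ∀ i, i ≠ k → (g i : S2) = l' i := fun i hi => by simp [g, hi]
  have hinj : g.Injective := by
    intro i j hij
    have hij : (g i : S2) = g j := congrArg _ hij
    by_cases hi : i = k
    · by_cases hj : j = k
      · rw [hi, hj]
      · rw [hi, hgk, hg j hj] at hij
        exact absurd hij.symm (hne j hj).2
    · by_cases hj : j = k
      · rw [hj, hgk, hg i hi] at hij
        exact absurd hij (hne i hi).2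
      · rw [hg i hi, hg j hj] at hij
        exact l'.injective (Subtype.ext hij)
  have hsurj : g.Surjective := by
    rintro ⟨x, hx⟩
    by_cases hxp : x = p
    · exact ⟨k, Subtype.ext (hgk.trans hxp.symm)⟩
    · have hx' : x ∈ L'.endpoints := by rw [hend]; exact Or.inr ⟨hx, hxp⟩
      refine ⟨l'.symm ⟨x, hx'⟩, Subtype.ext ?_⟩
      rw [hg]
      · simp
      · intro heq
        apply hp'
        rw [← hk, ← heq]
        simpa using hx
  rw [spec_eq_spec L l (Equiv.ofBijective g ⟨hinj, hsurj⟩)]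
  refine spec_eq_of_common_closures fun σ hσ => ?_
  obtain ⟨-, ⟨D, hD, rfl⟩, -⟩ := existsUnique_isVirtualClosure L' l' hσ
  obtain ⟨A, hA⟩ := isClosureDiagram_iff.1 hD
  exact ⟨D, D, isClosureDiagram_iff.2
    ⟨_, hA.of_endpointIsotopy hσ hp hpp' hedges hover hk hgk hg⟩, hD, rfl⟩

/-! ### Invariance under equivalence, and the theorem. -/

/-- The virtual spectrum is a linkoid invariant. -/
theorem spec_eq_of_linkoidEquiv {L L' : LinkoidDiagram n} (h : LinkoidEquiv L L')
    (l : L.Labelling) (l' : L'.Labelling) : spec L l = spec L' l' := by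
  induction h with
  | rel L L' h =>
    rcases h with h | h | h | h | h
    · exact spec_eq_of_isotopy h l l'
    · exact spec_eq_of_endpointIsotopy h l l'
    · exact spec_eq_of_reidemeisterI h l l'
    · exact spec_eq_of_reidemeisterII h l l'
    · exact spec_eq_of_reidemeisterIII h l l'
  | refl L => exact spec_eq_spec L l l'
  | symm L L' _ ih => exact (ih l' l).symm
  | trans L M L' _ _ ih₁ ih₂ =>
    obtain ⟨m⟩ := M.nonempty_labelling
    exact (ih₁ l m).trans (ih₂ m l')

end VirtualSpectrum

theorem theorem5p1 (n : ℕ) :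
    (∀ (L : VirtualSpectrum.LinkoidDiagram n) (l : L.Labelling),
      ∀ σ ∈ VirtualSpectrum.closurePermutations n,
        ∃! v : VirtualSpectrum.VirtualLink, VirtualSpectrum.IsVirtualClosure L l σ v) ∧
    (∀ (L L' : VirtualSpectrum.LinkoidDiagram n) (l : L.Labelling) (l' : L'.Labelling),
      VirtualSpectrum.LinkoidEquiv L L' →
        VirtualSpectrum.spec L l = VirtualSpectrum.spec L' l') :=
  ⟨fun L l _ hσ => VirtualSpectrum.existsUnique_isVirtualClosure L l hσ,
    fun _ _ l l' h => VirtualSpectrum.spec_eq_of_linkoidEquiv h l l'⟩
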